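/- Conventions: $\widehat f(\xi)=\int f(x)e^{-2\pi i x\cdot\xi}dx$, $\mathbb T^3=\mathbb R^3/\mathbb Z^3$, $D=\sqrt{-\Delta}$ has symbol $2\pi|\xi|$ (on $\mathbb T^3$: $2\pi|m|$, $m\in\mathbb Z^3$), and $e^{t\Delta}$ has symbol $e^{-4\pi^2t|\xi|^2}$. Functions and distributions take values in $\mathbb C^d$, $d$ arbitrary ($d=1$: scalar data, $d=3$: vector fields). $\dot H^{-\alpha}(\mathbb R^3)$ is the space of tempered distributions $f$ whose Fourier transform is a locally integrable function with $\|f\|_{\dot H^{-\alpha}}=\|D^{-\alpha}f\|_{L^2}=\|(2\pi|\xi|)^{-\alpha}\widehat f\|_{L^2}<\infty$; for mean zero distributions $f$ on $\mathbb T^3$, $\|f\|_{\dot H^{-\alpha}}=\big(\sum_{m\ne0}(2\pi|m|)^{-2\alpha}|\widehat f(m)|^2\big)^{1/2}$, which is finite exactly when $f\in H^{-\alpha}(\mathbb T^3)$. Let $(h_n)$ be independent real Gaussian random variables of mean zero and the same standard deviation $\sigma\ge 0$ on a probability space $(\Omega,\mathcal A,\mathcal P)$. Randomization on $\mathbb R^3$.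 Let $\phi\in C_c^\infty(\mathbb R^3)$ be nonnegative and even, with $\phi=1$ on $(-\frac12,\frac12)^3$ and $\phi=0$ off $[-1,1]^3$; put $\varphi(\xi)=\phi(\xi)/\sum_{n\in\mathbb Z^3}\phi(\xi-n)$, and let $\varphi(D-n)$ be the Fourier multiplier with symbol $\varphi(\xi-n)$. For $f\in\dot H^{-\alpha}(\mathbb R^3)$, the randomization $f^\omega\in\dot H^{-\alpha}(\mathbb R^3)$ is defined for almost every $\omega$ by $D^{-\alpha}f^\omega=\sum_{n\in\mathbb Z^3}h_n(\omega)\varphi(D-n)D^{-\alpha}f$, with convergence in $L^2(\mathbb R^3)$. Randomization on $\mathbb T^3$. Let $(e_n)$ be a countable orthonormal basis of $L^2(\mathbb T^3)$ consisting of eigenfunctions of the Laplacian with $\|e_n\|_{L^\infty}\le B$ for all $n$ (for example $e_n(x)=e^{2\pi i n\cdot x}$, $n\in\mathbb Z^3$, with $B=1$). For a mean zero $f\in H^{-\alpha}(\mathbb T^3)$ with $D^{-\alpha}f=\sum_n a_ne_n$, the mean zero randomization $f^\omega\in H^{-\alpha}(\mathbb T^3)$ is defined for almost every $\omega$ by $D^{-\alpha}f^\omega=\sum_n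 h_n(\omega)a_ne_n$, with convergence in $L^2(\mathbb T^3)$. Proposition 2.4. Let $0<\alpha<1$ and $2\le p,q<\infty$ with $\alpha p\le2$. There is a constant $C=C_{p,q,\alpha}>0$, depending only on $p,q,\alpha$, such that for every $T>0$ and every $r$ with $p,q\le r<\infty$ the following holds. For every $f\in\dot H^{-\alpha}(\mathbb R^3)$ the randomization $f^\omega$ exists almost surely, $(\omega,t,x)\mapsto e^{t\Delta}f^\omega(x)$ is measurable with respect to the completed product measure, and $$\|e^{t\Delta}f^\omega\|_{L^r(\Omega;L^p([0,T];L^q_x(\mathbb R^3)))}\le C\,\sigma\sqrt r\;T^{\frac1p-\frac\alpha2}\|f\|_{\dot H^{-\alpha}(\mathbb R^3)}.$$ For every mean zero $f\in H^{-\alpha}(\mathbb T^3)$ the same holds on $\mathbb T^3$, with $$\|e^{t\Delta}f^\omega\|_{L^r(\Omega;L^p([0,T];L^q_x(\mathbb T^3)))}\le C\,B\,\sigma\sqrt r\;T^{\frac1p-\frac\alpha2}\|f\|_{\dot H^{-\alpha}(\mathbb T^3)}.$$ -/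

import Mathlib

open MeasureTheory ProbabilityTheory SchwartzMap FourierTransform
open scoped ENNReal NNReal

noncomputable section

/- The circle `ℝ / ℤ` carries the Haar measure of mass `1`, as in Mathlib's theory of Fourier series
on the torus. -/
attribute [instance] instMeasureSpaceUnitAddCircle

namespace RandomHeat

/-- Three dimensional Euclidean space `ℝ³`. -/
abbrev E3 : Type := EuclideanSpace ℝ (Fin 3)

/-- The torus `𝕋³ = ℝ³ / ℤ³`, with its Haar probability measure as `volume`. -/
abbrev T3 : Type := UnitAddTorus (Fin 3)

/-- The lattice `ℤ³`. -/
abbrev Z3 : Type := Fin 3 → ℤ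

/-- A lattice point seen in `ℝ³`; `‖latticePoint n‖` is the Euclidean length `|n|`. -/
def latticePoint (n : Z3) : E3 := WithLp.toLp 2 (fun i => (n i : ℝ))

/-- The norm of `u` in `L^r(Ω; L^p([0,T]; L^q(X)))`, for a function `u ω t x`. -/
def mixedNorm {Ω X F : Type*} [MeasurableSpace Ω] [MeasurableSpace X] [NormedAddCommGroup F]
    (P : Measure Ω) (μ : Measure X) (r p q T : ℝ) (u : Ω → ℝ → X → F) : ℝ≥0∞ :=
  eLpNorm (fun ω =>
    eLpNorm (fun t => eLpNorm (fun x => u ω t x) (ENNReal.ofReal q) μ)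
      (ENNReal.ofReal p) (volume.restrict (Set.Icc 0 T))) (ENNReal.ofReal r) P

/-- `h` is a family of independent real random variables on `(Ω, P)`, all with the centred
Gaussian law of standard deviation `σ`. -/
def IsGaussianFamily {Ω ι : Type*} [MeasurableSpace Ω] (P : Measure Ω) (σ : ℝ≥0)
    (h : ι → Ω → ℝ) : Prop :=
  iIndepFun h P ∧ ∀ i, HasLaw (h i) (gaussianReal 0 (σ ^ 2)) P

/-! ### The whole space -/

section WholeSpace

variable {F : Type*} [NormedAddCommGroup F] [InnerProductSpace ℂ F] [CompleteSpace F]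

/-- The tempered distribution `u` is the locally integrable function `g`. -/
def IsRepresentedBy (u : 𝓢'(E3, F)) (g : E3 → F) : Prop :=
  LocallyIntegrable g volume ∧
    ∀ ψ : 𝓢(E3, ℂ), Integrable (fun ξ => ψ ξ • g ξ) volume ∧ u ψ = ∫ ξ, ψ ξ • g ξ

open Classical in
/-- The Fourier transform of `u` as a function, when it is one (and `0` otherwise). It is
determined up to a null set. -/
def hatFun (u : 𝓢'(E3, F)) : E3 → F :=
  if h : ∃ g : E3 → F, IsRepresentedBy (𝓕 u) g then h.choose else 0

/-- The norm of the homogeneous Sobolev space `Ḣ^s(ℝ³)`, that is, the `L²` norm of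
`(2π|ξ|)^s û(ξ)`; meaningful for `u` whose Fourier transform is a function. -/
def hdotNorm (s : ℝ) (u : 𝓢'(E3, F)) : ℝ≥0∞ :=
  eLpNorm (fun ξ => (2 * Real.pi * ‖ξ‖) ^ s • hatFun u ξ) 2 volume

/-- `u ∈ Ḣ^s(ℝ³)`: the Fourier transform of `u` is a locally integrable function and
`(2π|ξ|)^s û(ξ)` is square integrable. -/
def MemHdot (s : ℝ) (u : 𝓢'(E3, F)) : Prop :=
  (∃ g : E3 → F, IsRepresentedBy (𝓕 u) g) ∧ hdotNorm s u < ∞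

/-- `G = D^s u` where `D = √(-Δ)` has symbol `2π|ξ|`, for `u` with `D^s u ∈ L²`. -/
def IsDpow (s : ℝ) (u : 𝓢'(E3, F)) (G : Lp F 2 (volume : Measure E3)) : Prop :=
  MemHdot s u ∧
    ((𝓕 G : Lp F 2 (volume : Measure E3)) : E3 → F) =ᵐ[volume]
      fun ξ => (2 * Real.pi * ‖ξ‖) ^ s • hatFun u ξ

/-- The cut-off functions admitted in the smooth Wiener decomposition: nonnegative, even, smooth
with compact support, equal to `1` on `(-1/2, 1/2)³` and to `0` off `[-1, 1]³`. -/
structure IsCutoff (φ : E3 → ℝ) : Prop where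
  smooth : ContDiff ℝ (⊤ : ℕ∞) φ
  compact : HasCompactSupport φ
  nonneg : ∀ ξ, 0 ≤ φ ξ
  even : ∀ ξ, φ (-ξ) = φ ξ
  eq_one : ∀ ξ : E3, (∀ i, ξ i ∈ Set.Ioo (-(1 / 2) : ℝ) (1 / 2)) → φ ξ = 1
  eq_zero : ∀ ξ : E3, (¬ ∀ i, ξ i ∈ Set.Icc (-1 : ℝ) 1) → φ ξ = 0

/-- The normalized cut-off `φ(ξ) / ∑ₙ φ(ξ - n)`, whose integer translates sum to `1`. -/
def normalizedCutoff (φ : E3 → ℝ) (ξ : E3) : ℝ :=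
  φ ξ / ∑' n : Z3, φ (ξ - latticePoint n)

open Classical in
/-- The Fourier multiplier `m(D)` on `L²(ℝ³)`, `𝓕 (m(D) G) = m • 𝓕 G`, for `m` for which this is
square integrable (always so for bounded measurable `m`). -/
def fourierMultiplier (m : E3 → ℝ) (G : Lp F 2 (volume : Measure E3)) : Lp F 2 (volume : Measure E3) :=
  if h : MemLp (fun ξ => m ξ • ((𝓕 G : Lp F 2 (volume : Measure E3)) : E3 → F) ξ) 2 (volume : Measure E3)
  then 𝓕⁻ (h.toLp) else 0

/-- The frequency localization to the unit scale around `n`: the multiplier with symbol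
`ξ ↦ ψ(ξ - n)`, with `ψ` the normalized cut-off. -/
def wienerPiece (φ : E3 → ℝ) (n : Z3) (G : Lp F 2 (volume : Measure E3)) : Lp F 2 (volume : Measure E3) :=
  fourierMultiplier (fun ξ => normalizedCutoff φ (ξ - latticePoint n)) G

/-- `fω` is the Wiener randomization of `f ∈ Ḣ^{-α}(ℝ³)`: almost surely
`D^{-α} f^ω = ∑ₙ hₙ(ω) ψ(D - n) D^{-α} f`, with convergence in `L²(ℝ³)`. -/
def IsWienerRandomization {Ω : Type*} [MeasurableSpace Ω] (P : Measure Ω) (α : ℝ) (φ : E3 → ℝ)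
    (h : Z3 → Ω → ℝ) (f : 𝓢'(E3, F)) (fω : Ω → 𝓢'(E3, F)) : Prop :=
  ∃ G : Lp F 2 (volume : Measure E3), IsDpow (-α) f G ∧
    ∀ᵐ ω ∂P, ∃ Gω : Lp F 2 (volume : Measure E3), IsDpow (-α) (fω ω) Gω ∧
      HasSum (fun n : Z3 => (h n ω : ℂ) • wienerPiece φ n G) Gω

/-- The heat evolution
`(e^{tΔ} u)(x) = ∫ e^{2πi x·ξ} e^{-4π²t|ξ|²} û(ξ) dξ`. -/
def heat (t : ℝ) (u : 𝓢'(E3, F)) (x : E3) : F :=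
  𝓕⁻ (fun ξ : E3 => Real.exp (-t * (2 * Real.pi * ‖ξ‖) ^ 2) • hatFun u ξ) x

end WholeSpace

/-! ### The torus -/

section Torus

variable {F : Type*} [NormedAddCommGroup F] [InnerProductSpace ℂ F] [CompleteSpace F]

/-- A distribution on `𝕋³`, given by its Fourier series `∑ₘ coeff m e^{2πi m·x}`: the sequences
of Fourier coefficients of distributions are exactly those of polynomial growth. -/
structure TorusDistribution (F : Type*) [NormedAddCommGroup F] where
  coeff : Z3 → F
  growth : ∃ (A : ℝ) (k : ℕ), ∀ m, ‖coeff m‖ ≤ A * (1 + ‖latticePoint m‖) ^ k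

/-- The norm of the homogeneous Sobolev space `Ḣ^s(𝕋³)`, `(∑ₘ |(2π|m|)^s û(m)|²)^{1/2}`. -/
def torusHdotNorm (s : ℝ) (u : TorusDistribution F) : ℝ≥0∞ :=
  (∑' m : Z3, ‖(2 * Real.pi * ‖latticePoint m‖) ^ s • u.coeff m‖ₑ ^ 2) ^ (1 / 2 : ℝ)

/-- `u` has mean zero and lies in `H^s(𝕋³)`. -/
def TorusMemHdot (s : ℝ) (u : TorusDistribution F) : Prop :=
  u.coeff 0 = 0 ∧ torusHdotNorm s u < ∞

/-- `G = D^s u ∈ L²(𝕋³)`, for `u` of mean zero, where `D = √(-Δ)` has symbol `2π|m|`. -/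
def TorusIsDpow (s : ℝ) (u : TorusDistribution F) (G : Lp F 2 (volume : Measure T3)) : Prop :=
  TorusMemHdot s u ∧
    ∀ m : Z3, UnitAddTorus.mFourierCoeff (G : T3 → F) m =
      if m = 0 then 0 else (2 * Real.pi * ‖latticePoint m‖) ^ s • u.coeff m

/-- `e` is an eigenfunction of the Laplacian of `𝕋³`: `-Δ e = μ e` in the sense of distributions,
tested on the characters of the torus. -/
def IsLaplaceEigenfunction (e : Lp ℂ 2 (volume : Measure T3)) : Prop :=
  e ≠ 0 ∧ ∃ μ : ℝ, ∀ m : Z3,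
    ((2 * Real.pi * ‖latticePoint m‖) ^ 2 : ℝ) • UnitAddTorus.mFourierCoeff (e : T3 → ℂ) m =
      μ • UnitAddTorus.mFourierCoeff (e : T3 → ℂ) m

/-- The `F`-valued coefficient `∫ \overline{e(x)} G(x) dx` of `G` along `e`. -/
def coeffAlong (e : Lp ℂ 2 (volume : Measure T3)) (G : Lp F 2 (volume : Measure T3)) : F :=
  ∫ x : T3, (starRingEnd ℂ) ((e : T3 → ℂ) x) • (G : T3 → F) x

/-- The element `x ↦ e(x) a` of `L²(𝕋³; F)`. -/
def smulVec (e : Lp ℂ 2 (volume : Measure T3)) (a : F) : Lp F 2 (volume : Measure T3) :=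
  (ContinuousLinearMap.toSpanSingleton ℂ a).compLp e

/-- `fω` is the randomization of the mean zero `f ∈ H^{-α}(𝕋³)` in the orthonormal basis `e`:
if `D^{-α} f = ∑ᵢ aᵢ eᵢ`, then almost surely `D^{-α} f^ω = ∑ᵢ hᵢ(ω) aᵢ eᵢ`, with convergence in
`L²(𝕋³)`. -/
def IsTorusRandomization {Ω ι : Type*} [MeasurableSpace Ω] (P : Measure Ω) (α : ℝ)
    (e : HilbertBasis ι ℂ (Lp ℂ 2 (volume : Measure T3))) (h : ι → Ω → ℝ)
    (f : TorusDistribution F) (fω : Ω → TorusDistribution F) : Prop :=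
  ∃ G : Lp F 2 (volume : Measure T3), TorusIsDpow (-α) f G ∧
    ∀ᵐ ω ∂P, ∃ Gω : Lp F 2 (volume : Measure T3), TorusIsDpow (-α) (fω ω) Gω ∧
      HasSum (fun i : ι => (h i ω : ℂ) • smulVec (e i) (coeffAlong (e i) G)) Gω

/-- The heat evolution `(e^{tΔ} u)(x) = ∑ₘ e^{-4π²t|m|²} û(m) e^{2πi m·x}`. -/
def torusHeat (t : ℝ) (u : TorusDistribution F) (x : T3) : F :=
  ∑' m : Z3, UnitAddTorus.mFourier m x •
    (Real.exp (-t * (2 * Real.pi * ‖latticePoint m‖) ^ 2) • u.coeff m)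

end Torus

end RandomHeat

end

/-! Put `G = D^{-α} f`, an `L²` function whose norm is that of `f`. Applying `e^{tΔ} D^α`, whose
symbol `e^{-ts²} s^α` is `heatSymbol` at `s = 2π|ξ|`, to the random series for `D^{-α} f^ω` writes
`e^{tΔ} f^ω` as `∑ hₙ(ω) vₙ(t,x)` with deterministic `vₙ`. For fixed `t > 0` and `x` the evaluation
is a continuous functional on `L²`, so one almost sure set of `ω` gives convergence at all such
points.

Since `p, q ≤ r`, Minkowski moves the `L^r(Ω)` norm inside the space and time norms. The Gaussian
Khintchine inequality then costs `4 √r σ` and leaves the square function `S(t,x) = ∑ |vₙ(t,x)|²`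
(`mixedNorm_le_of_hasSum`).

The randomization gains integrability in `x`, because `S(t,·)` has the same bound in `L^∞` and in
`L¹`: a constant times the energy `∫ (e^{-ts²} s^α)² dν`, where `ν` is the spectral mass of `G`. On
`ℝ³` the uniform bound is Bernstein's inequality on frequency cells of bounded size, and the `L¹`
bound is Plancherel with bounded overlap. On `𝕋³` each eigenfunction has a single frequency, `|eᵢ| ≤
B`, and the total measure is one. Interpolation controls the `L^{q/2}` norm of `S(t,·)` without loss
in `q`.

Finally, as `p ≥ 2`, Minkowski exchanges time with frequency, and at each frequency `∫₀ᵀ e^{-pts²}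
s^{αp} dt ≤ s^{αp} min(T, s^{-2}) ≤ T^{1-αp/2}`, which is where `αp ≤ 2` enters. Both domains share
this last part, `lintegral_square_function_le`.

Existence of `f^ω` follows from the almost sure finiteness of `∑ hₙ² ‖Gₙ‖²`, where `Gₙ` are the
pieces of `G`, together with their (almost) orthogonality. -/

noncomputable section

namespace RandomHeat

open Filter Topology

/-! ### Minkowski's integral inequality -/

section Minkowski

variable {X Y : Type*} [MeasurableSpace X] [MeasurableSpace Y]

/-- Minkowski's integral inequality, for a measurable integrand. -/
theorem lintegral_lintegral_rpow_le_of_measurable (μ : Measure X) [IsFiniteMeasure μ]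
    (ν : Measure Y) [SFinite ν] {F : X × Y → ℝ≥0∞} (hF : Measurable F) {r : ℝ} (hr : 1 ≤ r) :
    (∫⁻ x, (∫⁻ y, F (x, y) ∂ν) ^ r ∂μ) ^ (1 / r) ≤ ∫⁻ y, (∫⁻ x, F (x, y) ^ r ∂μ) ^ (1 / r) ∂ν := by
  rcases hr.eq_or_lt with rfl | hr
  · simp only [ENNReal.rpow_one, div_one]
    exact (lintegral_lintegral_swap (f := fun x y => F (x, y)) hF.aemeasurable).le
  have hr0 : 0 < r := by linarith
  set M : ℝ≥0∞ := ∫⁻ y, (∫⁻ x, F (x, y) ^ r ∂μ) ^ (1 / r) ∂ν with hM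
  set A : X → ℝ≥0∞ := fun x => ∫⁻ y, F (x, y) ∂ν with hA
  have hAm : Measurable A := hF.lintegral_prod_right'
  have hpq : r.HolderConjugate (r / (r - 1)) := Real.HolderConjugate.conjExponent hr
  -- Duality argument: write the `r`-th power as `A · A^{r-1}`, apply Fubini and Hölder, then
  -- divide. Truncating at `N` on a finite measure space makes the divisor finite.
  have key : ∀ N : ℕ, ∫⁻ x, (min (A x) N) ^ r ∂μ ≤ M ^ r := by
    intro N
    have hmm : Measurable fun x => min (A x) (N : ℝ≥0∞) := hAm.min measurable_const
    set I : ℝ≥0∞ := ∫⁻ x, (min (A x) N) ^ r ∂μ with hI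
    have hItop : I ≠ ∞ := by
      refine ne_top_of_le_ne_top (b := ∫⁻ _, (N : ℝ≥0∞) ^ r ∂μ) ?_ ?_
      · rw [lintegral_const]
        exact ENNReal.mul_ne_top (ENNReal.rpow_ne_top_of_nonneg hr0.le (by simp))
          (measure_ne_top _ _)
      · exact lintegral_mono fun x => ENNReal.rpow_le_rpow (min_le_right _ _) hr0.le
    by_cases hI0 : I = 0
    · rw [hI0]; exact zero_le
    have h1 : I ≤ M * I ^ (1 / (r / (r - 1))) := by
      calc I = ∫⁻ x, min (A x) N * (min (A x) N) ^ (r - 1) ∂μ := by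
            refine lintegral_congr fun x => ?_
            have hne : min (A x) (N : ℝ≥0∞) ≠ ∞ :=
              ne_top_of_le_ne_top (by simp : (N : ℝ≥0∞) ≠ ∞) (min_le_right _ _)
            by_cases h0 : min (A x) (N : ℝ≥0∞) = 0
            · rw [h0, ENNReal.zero_rpow_of_pos hr0, zero_mul]
            · conv_rhs => rw [← ENNReal.rpow_one (min (A x) (N : ℝ≥0∞)), ← ENNReal.rpow_mul,
                ← ENNReal.rpow_add _ _ h0 hne]
              congr 1; ring
        _ ≤ ∫⁻ x, A x * (min (A x) N) ^ (r - 1) ∂μ :=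
            lintegral_mono fun x => mul_le_mul_left (min_le_left _ _) _
        _ = ∫⁻ x, ∫⁻ y, F (x, y) * (min (A x) N) ^ (r - 1) ∂ν ∂μ := by
            refine lintegral_congr fun x => ?_
            exact (lintegral_mul_const _ (f := fun y => F (x, y))
              (hF.comp measurable_prodMk_left)).symm
        _ = ∫⁻ y, ∫⁻ x, F (x, y) * (min (A x) N) ^ (r - 1) ∂μ ∂ν := by
            refine lintegral_lintegral_swap
              (f := fun x y => F (x, y) * (min (A x) N) ^ (r - 1)) ?_
            exact (hF.mul ((hmm.pow_const _).comp measurable_fst)).aemeasurable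
        _ ≤ ∫⁻ y, (∫⁻ x, F (x, y) ^ r ∂μ) ^ (1 / r) * I ^ (1 / (r / (r - 1))) ∂ν := by
            refine lintegral_mono fun y => ?_
            refine (ENNReal.lintegral_mul_le_Lp_mul_Lq μ hpq
              (hF.comp measurable_prodMk_right).aemeasurable
              (hmm.pow_const (r - 1)).aemeasurable).trans (le_of_eq ?_)
            congr 3
            funext x
            rw [← ENNReal.rpow_mul]
            congr 1
            field_simp [show r - 1 ≠ 0 by linarith]
        _ = M * I ^ (1 / (r / (r - 1))) := by
            rw [lintegral_mul_const _]
            exact ((hF.pow_const r).lintegral_prod_left').pow_const _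
    have h2 : I ^ (1 / r) ≤ M := by
      have hJ0 : I ^ (1 / (r / (r - 1))) ≠ 0 := by
        rw [Ne, ENNReal.rpow_eq_zero_iff]; tauto
      have hJt : I ^ (1 / (r / (r - 1))) ≠ ∞ :=
        ENNReal.rpow_ne_top_of_nonneg (by have := hpq.symm.nonneg; positivity) hItop
      rw [← ENNReal.mul_le_mul_iff_left hJ0 hJt, ← ENNReal.rpow_add _ _ hI0 hItop]
      convert! h1
      rw [show 1 / r + 1 / (r / (r - 1)) = 1 by field_simp; ring, ENNReal.rpow_one]
    calc I = (I ^ (1 / r)) ^ r := by rw [← ENNReal.rpow_mul]; simp [hr0.ne']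
      _ ≤ M ^ r := ENNReal.rpow_le_rpow h2 hr0.le
  have hlim : ∫⁻ x, A x ^ r ∂μ ≤ M ^ r := by
    refine le_of_tendsto' (lintegral_tendsto_of_tendsto_of_monotone
      (f := fun N : ℕ => fun x => (min (A x) N) ^ r)
      (fun N => ((hAm.min measurable_const).pow_const r).aemeasurable) ?_ ?_) key
    · refine ae_of_all _ fun x a b hab => ENNReal.rpow_le_rpow (min_le_min_left _ ?_) hr0.le
      exact_mod_cast hab
    · refine ae_of_all _ fun x => (ENNReal.continuous_rpow_const.tendsto _).comp ?_
      have := (tendsto_const_nhds (x := A x)).min ENNReal.tendsto_nat_nhds_top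
      simpa using this
  calc (∫⁻ x, A x ^ r ∂μ) ^ (1 / r) ≤ (M ^ r) ^ (1 / r) :=
        ENNReal.rpow_le_rpow hlim (by positivity)
    _ = M := by rw [← ENNReal.rpow_mul]; simp [hr0.ne']

/-- Minkowski's inequality `‖ ‖F‖_{L^s(ν)} ‖_{L^r(μ)} ≤ ‖ ‖F‖_{L^r(μ)} ‖_{L^s(ν)}` for `s ≤ r`. -/
theorem lintegral_rpow_swap_le (μ : Measure X) [IsFiniteMeasure μ] (ν : Measure Y) [SFinite ν]
    {F : X × Y → ℝ≥0∞} (hF : AEMeasurable F (μ.prod ν)) {r s : ℝ} (hs : 0 < s) (hsr : s ≤ r) :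
    (∫⁻ x, ((∫⁻ y, F (x, y) ^ s ∂ν) ^ (1 / s)) ^ r ∂μ) ^ (1 / r) ≤
      (∫⁻ y, ((∫⁻ x, F (x, y) ^ r ∂μ) ^ (1 / r)) ^ s ∂ν) ^ (1 / s) := by
  have hr : 0 < r := hs.trans_le hsr
  have hae := Measure.ae_ae_of_ae_prod hF.ae_eq_mk
  have hae' : ∀ᵐ y ∂ν, ∀ᵐ x ∂μ, F (x, y) = hF.mk F (x, y) := by
    have := (Measure.measurePreserving_swap (μ := ν) (ν := μ)).quasiMeasurePreserving.ae
      hF.ae_eq_mk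
    exact Measure.ae_ae_of_ae_prod this
  -- The case of inner exponent `1`, applied to `F^s` with outer exponent `r / s ≥ 1`.
  have h := lintegral_lintegral_rpow_le_of_measurable μ ν (F := fun z => hF.mk F z ^ s)
    (hF.measurable_mk.pow_const s) (r := r / s) ((one_le_div hs).2 hsr)
  have e1 : ∫⁻ x, ((∫⁻ y, F (x, y) ^ s ∂ν) ^ (1 / s)) ^ r ∂μ =
      ∫⁻ x, (∫⁻ y, hF.mk F (x, y) ^ s ∂ν) ^ (r / s) ∂μ := by
    refine lintegral_congr_ae (hae.mono fun x hx => ?_)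
    simp only
    rw [← ENNReal.rpow_mul, one_div_mul_eq_div,
      lintegral_congr_ae (g := fun y => hF.mk F (x, y) ^ s) (hx.mono fun y hy => by simp only [hy])]
  have e2 : ∫⁻ y, ((∫⁻ x, F (x, y) ^ r ∂μ) ^ (1 / r)) ^ s ∂ν =
      ∫⁻ y, (∫⁻ x, (hF.mk F (x, y) ^ s) ^ (r / s) ∂μ) ^ (1 / (r / s)) ∂ν := by
    refine lintegral_congr_ae (hae'.mono fun y hy => ?_)
    simp only
    rw [← ENNReal.rpow_mul, one_div_mul_eq_div, one_div_div]
    congr 1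
    refine lintegral_congr_ae (hy.mono fun x hx => ?_)
    simp only [hx]
    rw [← ENNReal.rpow_mul, mul_div_cancel₀ _ hs.ne']
  rw [e1, e2]
  calc (∫⁻ x, (∫⁻ y, hF.mk F (x, y) ^ s ∂ν) ^ (r / s) ∂μ) ^ (1 / r)
      = ((∫⁻ x, (∫⁻ y, hF.mk F (x, y) ^ s ∂ν) ^ (r / s) ∂μ) ^ (1 / (r / s))) ^ (1 / s) := by
        rw [← ENNReal.rpow_mul]; congr 1; field_simp
    _ ≤ _ := ENNReal.rpow_le_rpow h (by positivity)

end Minkowski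

/-! ### Moments of Gaussian sums with real coefficients -/

section Khintchine

variable {Ω : Type*} [MeasurableSpace Ω] {P : Measure Ω}

/-- Raise `y ≤ e^y`, at `y = t|x|/r`, to the power `r`; both signs of `x` are covered so that the
right side integrates to moment generating functions. -/
theorem abs_rpow_le_mul_exp {r t x : ℝ} (hr : 0 < r) (ht : 0 < t) :
    |x| ^ r ≤ (r / t) ^ r * (Real.exp (t * x) + Real.exp (-t * x)) := by
  have h1 : |x| = r / t * (t * |x| / r) := by field_simp
  have h2 : t * |x| / r ≤ Real.exp (t * |x| / r) := by
    linarith [Real.add_one_le_exp (t * |x| / r)]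
  have h3 : (t * |x| / r) ^ r ≤ Real.exp (t * |x|) := by
    calc (t * |x| / r) ^ r ≤ Real.exp (t * |x| / r) ^ r :=
          Real.rpow_le_rpow (by positivity) h2 hr.le
      _ = Real.exp (t * |x|) := by rw [← Real.exp_mul]; congr 1; field_simp
  have h4 : Real.exp (t * |x|) ≤ Real.exp (t * x) + Real.exp (-t * x) := by
    rcases abs_cases x with ⟨h, _⟩ | ⟨h, _⟩ <;> rw [h]
    · linarith [Real.exp_pos (-t * x)]
    · rw [mul_neg, ← neg_mul]; linarith [Real.exp_pos (t * x)]
  conv_lhs => rw [h1]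
  rw [Real.mul_rpow (by positivity) (by positivity)]
  gcongr
  exact h3.trans h4

/-- Moments of sub-Gaussian random variables grow at most like `√r`. -/
theorem lintegral_rpow_le_of_hasSubgaussianMGF [IsProbabilityMeasure P] {X : Ω → ℝ} {c : ℝ≥0}
    (h : HasSubgaussianMGF X c P) {r : ℝ} (hr : 1 ≤ r) :
    ∫⁻ ω, ‖X ω‖ₑ ^ r ∂P ≤ (ENNReal.ofReal (4 * √r * √c)) ^ r := by
  have hr0 : 0 < r := by linarith
  rcases eq_or_ne c 0 with rfl | hc
  · have := h.ae_eq_zero_of_hasSubgaussianMGF_zero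
    rw [lintegral_congr_ae (g := fun _ => 0) (this.mono fun ω hω => by simp [hω, hr0])]
    simp
  have hc' : (0 : ℝ) < c := by positivity
  -- This choice turns the prefactor into `(√r √c)^r` and the mgf bound into `e^{r/2} ≤ 2^r`. The
  -- two signs cost another `2 ≤ 2^r`, whence the constant `4 = 2 · 2`.
  set t : ℝ := √r / √c with ht
  have ht0 : 0 < t := by positivity
  have hrt : r / t = √r * √c := by
    rw [ht]; field_simp; rw [Real.sq_sqrt hr0.le]
  have hct : (c : ℝ) * t ^ 2 / 2 = r / 2 := by
    rw [ht, div_pow, Real.sq_sqrt hr0.le, Real.sq_sqrt hc'.le]; field_simp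
  have hint : Integrable (fun ω => (r / t) ^ r * (Real.exp (t * X ω) + Real.exp (-t * X ω))) P :=
    ((h.integrable_exp_mul t).add (h.integrable_exp_mul (-t))).const_mul _
  calc ∫⁻ ω, ‖X ω‖ₑ ^ r ∂P
      ≤ ∫⁻ ω, ENNReal.ofReal ((r / t) ^ r * (Real.exp (t * X ω) + Real.exp (-t * X ω))) ∂P := by
        refine lintegral_mono fun ω => ?_
        rw [← ofReal_norm, ENNReal.ofReal_rpow_of_nonneg (norm_nonneg _) hr0.le]
        exact ENNReal.ofReal_le_ofReal (abs_rpow_le_mul_exp hr0 ht0)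
    _ = ENNReal.ofReal ((r / t) ^ r * (mgf X P t + mgf X P (-t))) := by
        rw [← ofReal_integral_eq_lintegral_ofReal hint (ae_of_all _ fun ω => by positivity),
          integral_const_mul, integral_add (h.integrable_exp_mul t) (h.integrable_exp_mul (-t))]
        rfl
    _ ≤ ENNReal.ofReal ((4 * √r * √c) ^ r) := by
        refine ENNReal.ofReal_le_ofReal ?_
        have h1 := h.mgf_le t
        have h2 := h.mgf_le (-t)
        rw [neg_sq] at h2
        rw [hct] at h1 h2
        have h3 : Real.exp (r / 2) ≤ 2 ^ r := by
          rw [show r / 2 = (1 / 2) * r by ring, Real.exp_mul]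
          refine Real.rpow_le_rpow (Real.exp_pos _).le ?_ hr0.le
          have := Real.exp_one_lt_d9
          have h5 : Real.exp (1 / 2) ^ 2 = Real.exp 1 := by
            rw [← Real.exp_nat_mul]; norm_num
          nlinarith [Real.exp_pos (1 / 2 : ℝ)]
        have h4 : (2 : ℝ) ≤ 2 ^ r := by
          simpa using Real.rpow_le_rpow_of_exponent_le (x := 2) (by norm_num) hr
        rw [hrt, show 4 * √r * √(c : ℝ) = (√r * √c) * (2 * 2) by ring,
          Real.mul_rpow (x := √r * √(c : ℝ)) (by positivity) (by norm_num),
          Real.mul_rpow (x := 2) (y := 2) (by norm_num) (by norm_num)]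
        refine mul_le_mul_of_nonneg_left ?_ (by positivity)
        nlinarith [Real.exp_pos (r / 2)]
    _ = _ := by rw [ENNReal.ofReal_rpow_of_nonneg (by positivity) hr0.le]

theorem IsGaussianFamily.hasSubgaussianMGF {ι : Type*} {σ : ℝ≥0} {h : ι → Ω → ℝ}
    (hh : IsGaussianFamily P σ h) (i : ι) : HasSubgaussianMGF (h i) (σ ^ 2) P := by
  refine ⟨fun t => ?_, fun t => ?_⟩
  · have h1 := integrable_exp_mul_gaussianReal (μ := 0) (v := σ ^ 2) t
    rw [← (hh.2 i).map_eq] at h1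
    exact (integrable_map_measure h1.aestronglyMeasurable (hh.2 i).aemeasurable).1 h1
  · rw [mgf_gaussianReal (hh.2 i).map_eq]
    simp

/-- By independence the sub-Gaussian parameters add up, so only the `ℓ²` norm of the coefficients
survives. -/
theorem IsGaussianFamily.lintegral_sum_rpow_le [IsProbabilityMeasure P] {ι : Type*} {σ : ℝ≥0}
    {h : ι → Ω → ℝ} (hh : IsGaussianFamily P σ h) (S : Finset ι) (a : ι → ℝ) {r : ℝ}
    (hr : 1 ≤ r) :
    ∫⁻ ω, ‖∑ i ∈ S, a i * h i ω‖ₑ ^ r ∂P ≤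
      (ENNReal.ofReal (4 * √r * σ * √(∑ i ∈ S, a i ^ 2))) ^ r := by
  have hind : iIndepFun (fun i ω => a i * h i ω) P :=
    hh.1.comp (fun i x => a i * x) fun i => by fun_prop
  have := HasSubgaussianMGF.sum_of_iIndepFun hind (s := S)
    fun i _ => (hh.hasSubgaussianMGF i).const_mul (a i)
  refine (lintegral_rpow_le_of_hasSubgaussianMGF this hr).trans (le_of_eq ?_)
  congr 2
  push_cast
  change 4 * √r * √(∑ i ∈ S, a i ^ 2 * (σ : ℝ) ^ 2) = _
  rw [← Finset.sum_mul, Real.sqrt_mul (Finset.sum_nonneg fun i _ => sq_nonneg _),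
    Real.sqrt_sq σ.coe_nonneg]
  ring

end Khintchine

/-! ### Khintchine's inequality in `ℂ^d`, with a constant free of `d` -/

section VectorKhintchine

variable {Ω : Type*} [MeasurableSpace Ω] {P : Measure Ω} {d : ℕ}

/-- The real coordinates of a vector of `ℂ^d`. -/
def realCoord (v : EuclideanSpace ℂ (Fin d)) (k : Fin d × Bool) : ℝ :=
  if k.2 then (v k.1).re else (v k.1).im

theorem sum_realCoord_sq (v : EuclideanSpace ℂ (Fin d)) : ∑ k, realCoord v k ^ 2 = ‖v‖ ^ 2 := by
  rw [EuclideanSpace.norm_sq_eq, Fintype.sum_prod_type]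
  refine Finset.sum_congr rfl fun j _ => ?_
  rw [Complex.sq_norm, Complex.normSq_apply]
  simp [realCoord, sq]

theorem realCoord_sum {ι : Type*} (S : Finset ι) (a : ι → ℝ) (v : ι → EuclideanSpace ℂ (Fin d))
    (k : Fin d × Bool) :
    realCoord (∑ i ∈ S, (a i : ℂ) • v i) k = ∑ i ∈ S, realCoord (v i) k * a i := by
  obtain ⟨j, b⟩ := k
  cases b <;> simp [realCoord, mul_comm]

theorem sum_enorm_realCoord_sq (v : EuclideanSpace ℂ (Fin d)) :
    ∑ k, ‖realCoord v k‖ₑ ^ (2 : ℝ) = ‖v‖ₑ ^ (2 : ℝ) := by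
  simp only [← ofReal_norm]
  rw [ENNReal.ofReal_rpow_of_nonneg (norm_nonneg _) zero_le_two, Real.rpow_two,
    ← sum_realCoord_sq, ENNReal.ofReal_sum_of_nonneg fun _ _ => sq_nonneg _]
  refine Finset.sum_congr rfl fun k _ => ?_
  rw [ENNReal.ofReal_rpow_of_nonneg (norm_nonneg _) zero_le_two, Real.rpow_two]
  simp

/-- The Euclidean norm is the `ℓ²` norm of the real coordinates. As `r ≥ 2`, Minkowski takes
`L^r(Ω)` inside this `ℓ²` norm, and the real inequality applies to each coordinate without loss in
`d`. -/
theorem IsGaussianFamily.lintegral_sum_smul_rpow_le [IsProbabilityMeasure P] {ι : Type*} {σ : ℝ≥0}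
    {h : ι → Ω → ℝ} (hh : IsGaussianFamily P σ h) (S : Finset ι)
    (v : ι → EuclideanSpace ℂ (Fin d)) {r : ℝ} (hr : 2 ≤ r) :
    (∫⁻ ω, ‖∑ i ∈ S, (h i ω : ℂ) • v i‖ₑ ^ r ∂P) ^ (1 / r) ≤
      ENNReal.ofReal (4 * √r * σ) * (∑ i ∈ S, ‖v i‖ₑ ^ 2) ^ (1 / 2 : ℝ) := by
  have hr0 : 0 < r := by linarith
  have hmeas (k) : AEMeasurable (fun ω => ∑ i ∈ S, realCoord (v i) k * h i ω) P :=
    Finset.aemeasurable_fun_sum S fun i _ => (hh.2 i).aemeasurable.const_mul _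
  have hF : AEMeasurable (fun z : Ω × (Fin d × Bool) =>
      ‖∑ i ∈ S, realCoord (v i) z.2 * h i z.1‖ₑ) (P.prod Measure.count) := by
    choose g hg hgh using hmeas
    refine ⟨fun z => ‖g z.2 z.1‖ₑ, ?_, ?_⟩
    · exact (measurable_from_prod_countable_left (f := fun z : Ω × (Fin d × Bool) => g z.2 z.1)
        hg).enorm
    · have : ∀ᵐ ω ∂P, ∀ k, ∑ i ∈ S, realCoord (v i) k * h i ω = g k ω := ae_all_iff.2 hgh
      filter_upwards [Measure.quasiMeasurePreserving_fst.ae this] with z hz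
      simp only [hz]
  have key := lintegral_rpow_swap_le P Measure.count hF zero_lt_two hr
  simp only [lintegral_count, tsum_fintype] at key
  calc (∫⁻ ω, ‖∑ i ∈ S, (h i ω : ℂ) • v i‖ₑ ^ r ∂P) ^ (1 / r)
      = (∫⁻ ω, ((∑ k, ‖∑ i ∈ S, realCoord (v i) k * h i ω‖ₑ ^ (2 : ℝ)) ^ (1 / 2 : ℝ)) ^ r ∂P)
          ^ (1 / r) := by
        congr 1
        refine lintegral_congr fun ω => ?_
        congr 1
        simp only [← realCoord_sum, sum_enorm_realCoord_sq]
        rw [← ENNReal.rpow_mul]; norm_num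
    _ ≤ _ := key
    _ ≤ (∑ k, (ENNReal.ofReal (4 * √r * σ * √(∑ i ∈ S, realCoord (v i) k ^ 2))) ^ (2 : ℝ))
          ^ (1 / 2 : ℝ) := by
        gcongr with k
        calc _ ≤ ((ENNReal.ofReal (4 * √r * σ * √(∑ i ∈ S, realCoord (v i) k ^ 2))) ^ r)
              ^ (1 / r) := by
              gcongr
              exact hh.lintegral_sum_rpow_le S (fun i => realCoord (v i) k) (by linarith)
          _ = _ := by rw [← ENNReal.rpow_mul]; simp [hr0.ne']
    _ = (ENNReal.ofReal ((4 * √r * σ) ^ 2 * ∑ i ∈ S, ‖v i‖ ^ 2)) ^ (1 / 2 : ℝ) := by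
        congr 1
        simp_rw [← sum_realCoord_sq]
        rw [Finset.sum_comm, Finset.mul_sum, ENNReal.ofReal_sum_of_nonneg fun k _ =>
          mul_nonneg (sq_nonneg _) (Finset.sum_nonneg fun i _ => sq_nonneg _)]
        refine Finset.sum_congr rfl fun k _ => ?_
        rw [ENNReal.ofReal_rpow_of_nonneg (by positivity) zero_le_two, Real.rpow_two, mul_pow,
          Real.sq_sqrt (Finset.sum_nonneg fun i _ => sq_nonneg _)]
    _ = _ := by
        rw [ENNReal.ofReal_mul (sq_nonneg _), ENNReal.mul_rpow_of_nonneg _ _ (by norm_num)]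
        congr 1
        · rw [ENNReal.ofReal_rpow_of_nonneg (sq_nonneg _) (by norm_num), ← Real.sqrt_eq_rpow,
            Real.sqrt_sq (by positivity)]
        · congr 1
          rw [ENNReal.ofReal_sum_of_nonneg fun i _ => sq_nonneg _]
          refine Finset.sum_congr rfl fun i _ => ?_
          rw [ENNReal.ofReal_pow (norm_nonneg _), ofReal_norm]

/-- Khintchine's inequality for Gaussian series with values in `ℂ^d`. -/
theorem IsGaussianFamily.lintegral_hasSum_rpow_le [IsProbabilityMeasure P] {ι : Type*}
    [Countable ι] {σ : ℝ≥0} {h : ι → Ω → ℝ} (hh : IsGaussianFamily P σ h)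
    (v : ι → EuclideanSpace ℂ (Fin d)) {r : ℝ} (hr : 2 ≤ r) {u : Ω → EuclideanSpace ℂ (Fin d)}
    (hu : ∀ᵐ ω ∂P, HasSum (fun i => (h i ω : ℂ) • v i) (u ω)) :
    (∫⁻ ω, ‖u ω‖ₑ ^ r ∂P) ^ (1 / r) ≤
      ENNReal.ofReal (4 * √r * σ) * (∑' i, ‖v i‖ₑ ^ 2) ^ (1 / 2 : ℝ) := by
  have hr0 : 0 < r := by linarith
  set R := ENNReal.ofReal (4 * √r * σ) * (∑' i, ‖v i‖ₑ ^ 2) ^ (1 / 2 : ℝ) with hR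
  suffices ∫⁻ ω, ‖u ω‖ₑ ^ r ∂P ≤ R ^ r by
    calc _ ≤ (R ^ r) ^ (1 / r) := ENNReal.rpow_le_rpow this (by positivity)
      _ = R := by rw [← ENNReal.rpow_mul]; simp [hr0.ne']
  calc ∫⁻ ω, ‖u ω‖ₑ ^ r ∂P
      = ∫⁻ ω, liminf (fun S : Finset ι => ‖∑ i ∈ S, (h i ω : ℂ) • v i‖ₑ ^ r) atTop ∂P := by
        refine lintegral_congr_ae (hu.mono fun ω hω => ?_)
        exact ((((ENNReal.continuous_rpow_const (y := r)).comp continuous_enorm).tendsto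
          _).comp hω).liminf_eq.symm
    -- Fatou along the finite subsets, a countably generated filter because `ι` is countable.
    _ ≤ liminf (fun S : Finset ι => ∫⁻ ω, ‖∑ i ∈ S, (h i ω : ℂ) • v i‖ₑ ^ r ∂P) atTop := by
        refine lintegral_liminf_le' fun S => ?_
        refine AEMeasurable.pow_const (AEStronglyMeasurable.enorm ?_) _
        refine Finset.aestronglyMeasurable_fun_sum S fun i _ => ?_
        exact (Complex.continuous_ofReal.comp_aestronglyMeasurable
          (hh.2 i).aemeasurable.aestronglyMeasurable).smul_const _
    _ ≤ R ^ r := by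
        refine Filter.liminf_le_of_le (by isBoundedDefault) fun b hb => ?_
        obtain ⟨S, hS⟩ := hb.exists
        refine hS.trans ?_
        have h1 := hh.lintegral_sum_smul_rpow_le S v hr
        calc _ = ((∫⁻ ω, ‖∑ i ∈ S, (h i ω : ℂ) • v i‖ₑ ^ r ∂P) ^ (1 / r)) ^ r := by
              rw [← ENNReal.rpow_mul]; simp [hr0.ne']
          _ ≤ R ^ r := by
              refine ENNReal.rpow_le_rpow (h1.trans ?_) hr0.le
              rw [hR]
              gcongr
              exact ENNReal.sum_le_tsum S

end VectorKhintchine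

/-! ### From the mixed norm to the square function -/

section MixedNorm

variable {Ω X : Type*} [MeasurableSpace Ω] [MeasurableSpace X]

theorem eLpNorm_ofReal_eq {Y E : Type*} [MeasurableSpace Y] [TopologicalSpace E]
    [ContinuousENorm E] (μ : Measure Y) {p : ℝ}
    (hp : 0 < p) (f : Y → E) :
    eLpNorm f (ENNReal.ofReal p) μ = (∫⁻ y, ‖f y‖ₑ ^ p ∂μ) ^ (1 / p) := by
  rw [eLpNorm_eq_lintegral_rpow_enorm_toReal (by simpa using hp) (by simp),
    ENNReal.toReal_ofReal hp.le]

theorem lintegral_const_mul_rpow {Y : Type*} [MeasurableSpace Y] (ν : Measure Y) {s : ℝ}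
    (hs : 0 < s) {c : ℝ≥0∞} (hc : c ≠ ∞) (g : Y → ℝ≥0∞) :
    (∫⁻ y, (c * g y) ^ s ∂ν) ^ (1 / s) = c * (∫⁻ y, g y ^ s ∂ν) ^ (1 / s) := by
  simp_rw [ENNReal.mul_rpow_of_nonneg _ _ hs.le]
  rw [lintegral_const_mul' _ _ (ENNReal.rpow_ne_top_of_nonneg hs.le hc),
    ENNReal.mul_rpow_of_nonneg _ _ (by positivity), ← ENNReal.rpow_mul,
    mul_one_div_cancel hs.ne', ENNReal.rpow_one]

/-- Minkowski's inequality for the mixed norm: the integrability exponent in `Ω` is the largest. -/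
theorem mixedNorm_le_of_measurable (P : Measure Ω) [IsFiniteMeasure P] (μ : Measure X) [SFinite μ]
    (τ : Measure ℝ) [SFinite τ] {p q r : ℝ} (hp : 0 < p) (hq : 0 < q) (hpr : p ≤ r) (hqr : q ≤ r)
    {U : Ω × ℝ × X → ℝ≥0∞} (hU : Measurable U) :
    (∫⁻ ω, ((∫⁻ t, ((∫⁻ x, U (ω, t, x) ^ q ∂μ) ^ (1 / q)) ^ p ∂τ) ^ (1 / p)) ^ r ∂P) ^ (1 / r) ≤
      (∫⁻ t, ((∫⁻ x, ((∫⁻ ω, U (ω, t, x) ^ r ∂P) ^ (1 / r)) ^ q ∂μ) ^ (1 / q)) ^ p ∂τ)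
        ^ (1 / p) := by
  have h1 : Measurable fun z : Ω × ℝ => (∫⁻ x, U (z.1, z.2, x) ^ q ∂μ) ^ (1 / q) := by
    have h2 : Measurable fun y : (Ω × ℝ) × X => (y.1.1, y.1.2, y.2) := by fun_prop
    exact ((hU.comp h2).pow_const q).lintegral_prod_right'.pow_const _
  -- Exchange `Ω` first with time, at exponent `p`, and then, at each fixed time, with space, at
  -- exponent `q`.
  refine (lintegral_rpow_swap_le P τ h1.aemeasurable hp hpr).trans ?_
  gcongr with t
  refine lintegral_rpow_swap_le P μ (F := fun z => U (z.1, t, z.2)) ?_ hq hqr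
  exact (hU.comp (by fun_prop)).aemeasurable

/-- Minkowski followed by Khintchine at each point. The almost sure event in `hu` is the same for
all `z ∈ A`, which makes `u` an almost everywhere limit of jointly measurable partial sums. -/
theorem mixedNorm_le_of_hasSum {ι : Type*} [Countable ι] (P : Measure Ω) [IsProbabilityMeasure P]
    (μ : Measure X) [SFinite μ] {d : ℕ} {p q r T : ℝ} (hp : 2 ≤ p) (hq : 2 ≤ q) (hpr : p ≤ r)
    (hqr : q ≤ r) {σ : ℝ≥0} {h : ι → Ω → ℝ} (hh : IsGaussianFamily P σ h)
    {v : ι → ℝ → X → EuclideanSpace ℂ (Fin d)} {u : Ω → ℝ → X → EuclideanSpace ℂ (Fin d)}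
    (hv : ∀ i, AEStronglyMeasurable (fun z : ℝ × X => v i z.1 z.2)
      ((volume.restrict (Set.Icc 0 T)).prod μ))
    {A : Set (ℝ × X)} (hA : ∀ᵐ z ∂((volume.restrict (Set.Icc 0 T)).prod μ), z ∈ A)
    (hu : ∀ᵐ ω ∂P, ∀ z ∈ A, HasSum (fun i => (h i ω : ℂ) • v i z.1 z.2) (u ω z.1 z.2)) :
    AEStronglyMeasurable (fun z : Ω × ℝ × X => u z.1 z.2.1 z.2.2)
      (P.prod ((volume.restrict (Set.Icc 0 T)).prod μ)) ∧
    mixedNorm P μ r p q T u ≤ ENNReal.ofReal (4 * √r * σ) *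
      (∫⁻ t in Set.Icc 0 T, ((∫⁻ x, ((∑' i, ‖v i t x‖ₑ ^ 2) ^ (1 / 2 : ℝ)) ^ q ∂μ) ^ (1 / q)) ^ p)
        ^ (1 / p) := by
  set τ : Measure ℝ := volume.restrict (Set.Icc 0 T) with hτ
  have hp0 : 0 < p := by linarith
  have hq0 : 0 < q := by linarith
  have hr0 : 0 < r := by linarith
  have hmeas : AEStronglyMeasurable (fun z : Ω × ℝ × X => u z.1 z.2.1 z.2.2)
      (P.prod (τ.prod μ)) := by
    refine aestronglyMeasurable_of_tendsto_ae (atTop : Filter (Finset ι))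
      (f := fun S z => ∑ i ∈ S, (h i z.1 : ℂ) • v i z.2.1 z.2.2) (fun S => ?_) ?_
    · refine Finset.aestronglyMeasurable_fun_sum S fun i _ => ?_
      have h1 : AEStronglyMeasurable (fun ω => (h i ω : ℂ)) P :=
        Complex.continuous_ofReal.comp_aestronglyMeasurable
          (hh.2 i).aemeasurable.aestronglyMeasurable
      exact h1.comp_fst.smul (hv i).comp_snd
    · filter_upwards [Measure.quasiMeasurePreserving_fst.ae hu,
        Measure.quasiMeasurePreserving_snd.ae hA] with z hz1 hz2
      exact hz1 _ hz2
  refine ⟨hmeas, ?_⟩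
  have hU := hmeas.enorm
  set U := hU.mk with hUdef
  have hae : ∀ᵐ ω ∂P, ∀ᵐ t ∂τ, ∀ᵐ x ∂μ, ‖u ω t x‖ₑ = U (ω, t, x) :=
    (Measure.ae_ae_of_ae_prod hU.ae_eq_mk).mono fun ω hω => Measure.ae_ae_of_ae_prod hω
  have hae' : ∀ᵐ z ∂(τ.prod μ), ∀ᵐ ω ∂P, ‖u ω z.1 z.2‖ₑ = U (ω, z) :=
    Measure.ae_ae_of_ae_prod ((Measure.measurePreserving_swap
      (μ := τ.prod μ) (ν := P)).quasiMeasurePreserving.ae hU.ae_eq_mk)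
  have e1 : mixedNorm P μ r p q T u = (∫⁻ ω, ((∫⁻ t, ((∫⁻ x, U (ω, t, x) ^ q ∂μ) ^ (1 / q)) ^ p ∂τ)
      ^ (1 / p)) ^ r ∂P) ^ (1 / r) := by
    unfold mixedNorm
    simp only [eLpNorm_ofReal_eq _ hp0, eLpNorm_ofReal_eq _ hq0, eLpNorm_ofReal_eq _ hr0,
      enorm_eq_self, ← hτ]
    congr 1
    refine lintegral_congr_ae (hae.mono fun ω hω => ?_)
    simp only
    congr 2
    refine lintegral_congr_ae (hω.mono fun t ht => ?_)
    simp only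
    congr 2
    refine lintegral_congr_ae (ht.mono fun x hx => ?_)
    simp only [hx]
  rw [e1]
  refine (mixedNorm_le_of_measurable P μ τ hp0 hq0 hpr hqr hU.measurable_mk).trans ?_
  set c := ENNReal.ofReal (4 * √r * σ) with hc
  have hctop : c ≠ ∞ := ENNReal.ofReal_ne_top
  have hpt : ∀ᵐ z ∂(τ.prod μ), (∫⁻ ω, U (ω, z) ^ r ∂P) ^ (1 / r) ≤
      c * (∑' i, ‖v i z.1 z.2‖ₑ ^ 2) ^ (1 / 2 : ℝ) := by
    filter_upwards [hA, hae'] with z hz1 hz2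
    rw [← lintegral_congr_ae (f := fun ω => ‖u ω z.1 z.2‖ₑ ^ r)
      (hz2.mono fun ω hω => by simp only [hω])]
    exact hh.lintegral_hasSum_rpow_le (fun i => v i z.1 z.2) (by linarith)
      (hu.mono fun ω hω => hω z hz1)
  rw [← lintegral_const_mul_rpow _ hp0 hctop]
  refine ENNReal.rpow_le_rpow (lintegral_mono_ae ?_) (by positivity)
  filter_upwards [Measure.ae_ae_of_ae_prod hpt] with t ht
  refine ENNReal.rpow_le_rpow ?_ hp0.le
  rw [← lintegral_const_mul_rpow _ hq0 hctop]
  refine ENNReal.rpow_le_rpow (lintegral_mono_ae ?_) (by positivity)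
  filter_upwards [ht] with x hx
  exact ENNReal.rpow_le_rpow hx hq0.le

end MixedNorm

/-! ### Parabolic smoothing in time and the square function estimate -/

section HeatSymbol

/-- The symbol `e^{-ts²} s^α` of `e^{tΔ} D^α` at the frequency of length `s`. -/
def heatSymbol (α t s : ℝ) : ℝ := Real.exp (-t * s ^ 2) * s ^ α

theorem measurable_heatSymbol (α : ℝ) : Measurable fun z : ℝ × ℝ => heatSymbol α z.1 z.2 := by
  unfold heatSymbol; fun_prop

theorem heatSymbol_nonneg (α t : ℝ) {s : ℝ} (hs : 0 ≤ s) : 0 ≤ heatSymbol α t s := by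
  unfold heatSymbol; positivity

theorem min_le_rpow_mul_rpow {a b θ : ℝ} (ha : 0 < a) (hb : 0 < b) (hθ0 : 0 ≤ θ) (hθ1 : θ ≤ 1) :
    min a b ≤ a ^ (1 - θ) * b ^ θ := by
  have hm : 0 < min a b := lt_min ha hb
  calc min a b = min a b ^ (1 - θ) * min a b ^ θ := by
        rw [← Real.rpow_add hm]; simp
    _ ≤ a ^ (1 - θ) * b ^ θ := by
        have h1 : 0 ≤ 1 - θ := by linarith
        exact mul_le_mul (Real.rpow_le_rpow hm.le (min_le_left _ _) h1)
          (Real.rpow_le_rpow hm.le (min_le_right _ _) hθ0) (by positivity) (by positivity)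

theorem setLIntegral_exp_neg_mul_le {b : ℝ} (hb : 0 < b) (T : ℝ) :
    ∫⁻ t in Set.Icc 0 T, ENNReal.ofReal (Real.exp (-b * t)) ≤ ENNReal.ofReal (min T (1 / b)) := by
  rw [ENNReal.ofReal_min]
  refine le_min ?_ ?_
  · calc ∫⁻ t in Set.Icc 0 T, ENNReal.ofReal (Real.exp (-b * t))
        ≤ ∫⁻ t in Set.Icc 0 T, 1 := by
          refine setLIntegral_mono measurable_const fun t ht => ?_
          rw [← ENNReal.ofReal_one]
          refine ENNReal.ofReal_le_ofReal (Real.exp_le_one_iff.2 ?_)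
          nlinarith [ht.1]
      _ = ENNReal.ofReal T := by simp
  · have hint := integrableOn_exp_mul_Ioi (neg_lt_zero.2 hb) 0
    calc ∫⁻ t in Set.Icc 0 T, ENNReal.ofReal (Real.exp (-b * t))
        ≤ ∫⁻ t in Set.Ici 0, ENNReal.ofReal (Real.exp (-b * t)) :=
          lintegral_mono_set Set.Icc_subset_Ici_self
      _ = ∫⁻ t in Set.Ioi 0, ENNReal.ofReal (Real.exp (-b * t)) :=
          setLIntegral_congr Ioi_ae_eq_Ici.symm
      _ = ENNReal.ofReal (∫ t in Set.Ioi 0, Real.exp (-b * t)) :=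
          (ofReal_integral_eq_lintegral_ofReal hint (ae_of_all _ fun _ => (Real.exp_pos _).le)).symm
      _ ≤ ENNReal.ofReal (1 / b) := by
          rw [integral_exp_mul_Ioi (neg_lt_zero.2 hb)]; simp

/-- The smoothing of the heat flow, integrated in time. -/
theorem setLIntegral_heatSymbol_rpow_le {α p s T : ℝ} (hα : 0 < α) (hp : 2 ≤ p) (hαp : α * p ≤ 2)
    (hs : 0 ≤ s) (hT : 0 < T) :
    ∫⁻ t in Set.Icc 0 T, ENNReal.ofReal (heatSymbol α t s) ^ p ≤
      ENNReal.ofReal (T ^ (1 - α * p / 2)) := by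
  have hp0 : 0 < p := by linarith
  rcases hs.eq_or_lt with rfl | hs
  · simp [heatSymbol, Real.zero_rpow hα.ne', hp0]
  have e (t : ℝ) : ENNReal.ofReal (heatSymbol α t s) ^ p =
      ENNReal.ofReal (s ^ (α * p)) * ENNReal.ofReal (Real.exp (-(p * s ^ 2) * t)) := by
    rw [ENNReal.ofReal_rpow_of_nonneg (heatSymbol_nonneg _ _ hs.le) hp0.le,
      ← ENNReal.ofReal_mul (by positivity), heatSymbol,
      Real.mul_rpow (by positivity) (by positivity), ← Real.exp_mul, ← Real.rpow_mul hs.le, mul_comm]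
    congr 3; ring
  simp_rw [e]
  rw [lintegral_const_mul' _ _ ENNReal.ofReal_ne_top]
  calc _ ≤ ENNReal.ofReal (s ^ (α * p)) * ENNReal.ofReal (min T (1 / (p * s ^ 2))) := by
        gcongr
        exact setLIntegral_exp_neg_mul_le (by positivity) T
    _ = ENNReal.ofReal (s ^ (α * p) * min T (1 / (p * s ^ 2))) :=
        (ENNReal.ofReal_mul (by positivity)).symm
    _ ≤ _ := by
        refine ENNReal.ofReal_le_ofReal ?_
        -- The factor `p ≥ 1` is dropped. The geometric mean with weight `θ = αp/2 ≤ 1` on `s^{-2}`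
        -- then cancels `s^{αp}` exactly.
        have h1 : min T (1 / (p * s ^ 2)) ≤ min T ((s ^ 2)⁻¹) := by
          refine min_le_min_left _ ?_
          rw [one_div]
          refine inv_anti₀ (by positivity) ?_
          nlinarith [sq_nonneg s]
        have h2 := min_le_rpow_mul_rpow hT (show 0 < (s ^ 2)⁻¹ by positivity)
          (show 0 ≤ α * p / 2 by positivity) (by linarith)
        have h3 : s ^ (α * p) * ((s ^ 2)⁻¹) ^ (α * p / 2) = 1 := by
          rw [Real.inv_rpow (by positivity), ← Real.rpow_natCast, ← Real.rpow_mul hs.le,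
            show ((2 : ℕ) : ℝ) * (α * p / 2) = α * p by push_cast; ring]
          exact mul_inv_cancel₀ (by positivity)
        calc _ ≤ s ^ (α * p) * (T ^ (1 - α * p / 2) * ((s ^ 2)⁻¹) ^ (α * p / 2)) := by
              gcongr; exact h1.trans h2
          _ = _ := by rw [mul_left_comm, h3, mul_one]

/-- Interpolation between `L^∞` and `L¹`: `S^{q/2} = S^{q/2-1} S ≤ w^{q/2-1} S`. With the same `w`
at both ends, no constant depending on `q` appears. -/
theorem lintegral_rpow_half_le {X : Type*} [MeasurableSpace X] (μ : Measure X) {q : ℝ}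
    (hq : 2 ≤ q) {S : X → ℝ≥0∞} {w : ℝ≥0∞} (h1 : ∀ᵐ x ∂μ, S x ≤ w) (h2 : ∫⁻ x, S x ∂μ ≤ w) :
    (∫⁻ x, (S x ^ (1 / 2 : ℝ)) ^ q ∂μ) ^ (1 / q) ≤ w ^ (1 / 2 : ℝ) := by
  have hq0 : 0 < q := by linarith
  have split (a : ℝ≥0∞) : a ^ (q / 2) = a ^ (q / 2 - 1) * a := by
    conv_lhs => rw [show q / 2 = (q / 2 - 1) + 1 by ring,
      ENNReal.rpow_add_of_nonneg _ _ (by linarith) zero_le_one, ENNReal.rpow_one]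
  have key : ∫⁻ x, (S x ^ (1 / 2 : ℝ)) ^ q ∂μ ≤ w ^ (q / 2) := by
    rcases eq_or_ne w ∞ with rfl | hw
    · rw [ENNReal.top_rpow_of_pos (by positivity)]; exact le_top
    calc ∫⁻ x, (S x ^ (1 / 2 : ℝ)) ^ q ∂μ ≤ ∫⁻ x, w ^ (q / 2 - 1) * S x ∂μ := by
          refine lintegral_mono_ae (h1.mono fun x hx => ?_)
          rw [← ENNReal.rpow_mul, one_div_mul_eq_div, split]
          gcongr
          linarith
      _ = w ^ (q / 2 - 1) * ∫⁻ x, S x ∂μ :=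
          lintegral_const_mul' _ _ (ENNReal.rpow_ne_top_of_nonneg (by linarith) hw)
      _ ≤ w ^ (q / 2 - 1) * w := by gcongr
      _ = _ := (split w).symm
  calc _ ≤ (w ^ (q / 2)) ^ (1 / q) := ENNReal.rpow_le_rpow key (by positivity)
    _ = _ := by rw [← ENNReal.rpow_mul]; congr 1; field_simp

/-- A square function which is controlled, uniformly and on average in space, by the energy of
`e^{tΔ} D^α` of an `L²` density. -/
theorem lintegral_square_function_le {X Y : Type*} [MeasurableSpace X] [MeasurableSpace Y]
    (μ : Measure X) (ν : Measure Y) [SFinite ν] {s : Y → ℝ} (hs : Measurable s)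
    (hs0 : ∀ y, 0 ≤ s y) {α p q T : ℝ} (hα : 0 < α) (hp : 2 ≤ p) (hq : 2 ≤ q) (hαp : α * p ≤ 2)
    (hT : 0 < T) {c : ℝ≥0∞} (hc : c ≠ ∞) {S : ℝ → X → ℝ≥0∞}
    (h1 : ∀ t, 0 < t → ∀ᵐ x ∂μ, S t x ≤ c * ∫⁻ y, ENNReal.ofReal (heatSymbol α t (s y)) ^ 2 ∂ν)
    (h2 : ∀ t, 0 < t → ∫⁻ x, S t x ∂μ ≤ c * ∫⁻ y, ENNReal.ofReal (heatSymbol α t (s y)) ^ 2 ∂ν) :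
    (∫⁻ t in Set.Icc 0 T, ((∫⁻ x, (S t x ^ (1 / 2 : ℝ)) ^ q ∂μ) ^ (1 / q)) ^ p) ^ (1 / p) ≤
      c ^ (1 / 2 : ℝ) * (ENNReal.ofReal (T ^ (1 / p - α / 2)) * ν Set.univ ^ (1 / 2 : ℝ)) := by
  have hp0 : 0 < p := by linarith
  set τ : Measure ℝ := volume.restrict (Set.Icc 0 T) with hτ
  have hpos : ∀ᵐ t ∂τ, 0 < t := by
    rw [hτ, ← restrict_Ioc_eq_restrict_Icc]
    filter_upwards [ae_restrict_mem measurableSet_Ioc] with t ht using ht.1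
  have hm : Measurable fun z : ℝ × Y => ENNReal.ofReal (heatSymbol α z.1 (s z.2)) :=
    ((measurable_heatSymbol α).comp (measurable_fst.prodMk (hs.comp measurable_snd))).ennreal_ofReal
  -- As `p ≥ 2`, the `L^p` norm in time passes inside the `L²(ν)` norm in frequency, so the
  -- smoothing estimate can be used one frequency at a time.
  have key := lintegral_rpow_swap_le τ ν hm.aemeasurable zero_lt_two hp
  have htime (y : Y) : (∫⁻ t, ENNReal.ofReal (heatSymbol α t (s y)) ^ p ∂τ) ^ (1 / p) ≤
      ENNReal.ofReal (T ^ (1 / p - α / 2)) := by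
    calc _ ≤ (ENNReal.ofReal (T ^ (1 - α * p / 2))) ^ (1 / p) :=
          ENNReal.rpow_le_rpow (setLIntegral_heatSymbol_rpow_le hα hp hαp (hs0 y) hT)
            (by positivity)
      _ = _ := by
          rw [ENNReal.ofReal_rpow_of_nonneg (by positivity) (by positivity),
            ← Real.rpow_mul hT.le]
          congr 2; field_simp
  calc _ ≤ (∫⁻ t, (c ^ (1 / 2 : ℝ) * (∫⁻ y, ENNReal.ofReal (heatSymbol α t (s y)) ^ (2 : ℝ) ∂ν)
        ^ (1 / 2 : ℝ)) ^ p ∂τ) ^ (1 / p) := by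
        refine ENNReal.rpow_le_rpow (lintegral_mono_ae ?_) (by positivity)
        filter_upwards [hpos] with t ht
        refine ENNReal.rpow_le_rpow ?_ hp0.le
        rw [← ENNReal.mul_rpow_of_nonneg _ _ (by norm_num)]
        simp only [ENNReal.rpow_two]
        exact lintegral_rpow_half_le μ hq (h1 t ht) (h2 t ht)
    _ = c ^ (1 / 2 : ℝ) * (∫⁻ t, ((∫⁻ y, ENNReal.ofReal (heatSymbol α t (s y)) ^ (2 : ℝ) ∂ν)
        ^ (1 / 2 : ℝ)) ^ p ∂τ) ^ (1 / p) :=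
        lintegral_const_mul_rpow _ hp0 (ENNReal.rpow_ne_top_of_nonneg (by norm_num) hc) _
    _ ≤ c ^ (1 / 2 : ℝ) * (∫⁻ _, (ENNReal.ofReal (T ^ (1 / p - α / 2))) ^ (2 : ℝ) ∂ν)
        ^ (1 / 2 : ℝ) := by
        refine mul_le_mul_right (key.trans ?_) _
        refine ENNReal.rpow_le_rpow (lintegral_mono fun y => ?_) (by norm_num)
        exact ENNReal.rpow_le_rpow (htime y) zero_le_two
    _ = _ := by
        rw [lintegral_const, ENNReal.mul_rpow_of_nonneg _ _ (by norm_num), ← ENNReal.rpow_mul]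
        norm_num

end HeatSymbol

/-! ### Almost sure convergence of the randomized series -/

section RandomSeries

/-- Unconditional convergence of square summable almost orthogonal series. -/
theorem summable_of_norm_sum_sq_le {ι E : Type*} [NormedAddCommGroup E] [CompleteSpace E]
    {x : ι → E} {b : ι → ℝ} {K : ℝ} (h : ∀ S : Finset ι, ‖∑ i ∈ S, x i‖ ^ 2 ≤ K * ∑ i ∈ S, b i)
    (hb : Summable b) : Summable x := by
  rw [summable_iff_vanishing_norm]
  intro ε hε
  have hK : 0 < |K| + 1 := by positivity
  obtain ⟨s, hs⟩ := summable_iff_vanishing_norm.1 hb (ε ^ 2 / (|K| + 1)) (by positivity)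
  refine ⟨s, fun t ht => ?_⟩
  refine lt_of_pow_lt_pow_left₀ 2 hε.le ((h t).trans_lt ?_)
  have h1 := hs t ht
  rw [lt_div_iff₀ hK, Real.norm_eq_abs] at h1
  calc K * ∑ i ∈ t, b i ≤ |K * ∑ i ∈ t, b i| := le_abs_self _
    _ = |∑ i ∈ t, b i| * |K| := by rw [abs_mul, mul_comm]
    _ ≤ |∑ i ∈ t, b i| * (|K| + 1) := by gcongr; linarith
    _ < ε ^ 2 := h1

variable {Ω : Type*} [MeasurableSpace Ω] {P : Measure Ω}

/-- The second moments of the `h i` are uniformly bounded, so the expectation of the sum is finite,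
and hence the sum is finite almost surely. -/
theorem IsGaussianFamily.ae_summable_sq_mul [IsProbabilityMeasure P] {ι : Type*} [Countable ι]
    {σ : ℝ≥0} {h : ι → Ω → ℝ} (hh : IsGaussianFamily P σ h) {b : ι → ℝ} (hb0 : ∀ i, 0 ≤ b i)
    (hb : Summable b) : ∀ᵐ ω ∂P, Summable fun i => h i ω ^ 2 * b i := by
  have hm (i : ι) : AEMeasurable (fun ω => ‖h i ω‖ₑ ^ (2 : ℝ) * ENNReal.ofReal (b i)) P :=
    ((hh.2 i).aemeasurable.enorm.pow_const _).mul_const _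
  have hfin : ∫⁻ ω, ∑' i, ‖h i ω‖ₑ ^ (2 : ℝ) * ENNReal.ofReal (b i) ∂P ≠ ∞ := by
    rw [lintegral_tsum hm]
    have hle (i : ι) : ∫⁻ ω, ‖h i ω‖ₑ ^ (2 : ℝ) * ENNReal.ofReal (b i) ∂P ≤
        ENNReal.ofReal (4 * √2 * √(σ ^ 2 : ℝ≥0)) ^ (2 : ℝ) * ENNReal.ofReal (b i) := by
      rw [lintegral_mul_const' _ _ ENNReal.ofReal_ne_top]
      gcongr
      exact lintegral_rpow_le_of_hasSubgaussianMGF (hh.hasSubgaussianMGF i) one_le_two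
    refine ne_top_of_le_ne_top ?_ (ENNReal.tsum_le_tsum hle)
    rw [ENNReal.tsum_mul_left]
    refine ENNReal.mul_ne_top (ENNReal.rpow_ne_top_of_nonneg zero_le_two ENNReal.ofReal_ne_top) ?_
    exact hb.tsum_ofReal_ne_top
  filter_upwards [ae_lt_top' (AEMeasurable.tsum hm) hfin] with ω hω
  have := ENNReal.summable_toReal hω.ne
  refine this.congr fun i => ?_
  rw [ENNReal.toReal_mul, ENNReal.toReal_ofReal (hb0 i), ← ENNReal.toReal_rpow]
  simp

/-- Almost sure unconditional convergence of the randomization of an almost orthogonal series. -/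
theorem IsGaussianFamily.ae_summable_smul [IsProbabilityMeasure P] {ι E : Type*} [Countable ι]
    [NormedAddCommGroup E] [NormedSpace ℂ E] [CompleteSpace E]
    {σ : ℝ≥0} {h : ι → Ω → ℝ} (hh : IsGaussianFamily P σ h) {G : ι → E} {b : ι → ℝ} {K : ℝ}
    (hb0 : ∀ i, 0 ≤ b i) (hb : Summable b)
    (hG : ∀ (S : Finset ι) (c : ι → ℝ), ‖∑ i ∈ S, (c i : ℂ) • G i‖ ^ 2 ≤ K * ∑ i ∈ S, c i ^ 2 * b i) :
    ∀ᵐ ω ∂P, Summable fun i => (h i ω : ℂ) • G i :=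
  (hh.ae_summable_sq_mul hb0 hb).mono fun ω hω =>
    summable_of_norm_sum_sq_le (fun S => hG S fun i => h i ω) hω

end RandomSeries

/-! ### Crude bounds for the heat symbol at a fixed positive time -/

section Auxiliary

theorem rpow_le_one_add {a α : ℝ} (ha : 0 ≤ a) (hα0 : 0 ≤ α) (hα1 : α ≤ 1) : a ^ α ≤ 1 + a := by
  rcases le_total a 1 with h | h
  · linarith [Real.rpow_le_one ha h hα0]
  · have := Real.rpow_le_rpow_of_exponent_le h hα1
    rw [Real.rpow_one] at this
    linarith

/-- Half of the Gaussian decay absorbs the growth: `s^{2α} ≤ 1 + s² ≤ (1 + 1/t) e^{ts²}`. The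
blow-up as `t → 0` is harmless, since the bound serves only qualitative purposes: integrability,
summability and continuity at fixed `t`. -/
theorem heatSymbol_sq_le {α t s : ℝ} (hα0 : 0 ≤ α) (hα1 : α ≤ 1) (ht : 0 < t) (hs : 0 ≤ s) :
    heatSymbol α t s ^ 2 ≤ (1 + 1 / t) * Real.exp (-t * s ^ 2) := by
  have h1 : (s ^ α) ^ 2 ≤ 1 + s ^ 2 := by
    have := rpow_le_one_add (sq_nonneg s) hα0 hα1
    rwa [← Real.rpow_natCast, ← Real.rpow_mul hs, mul_comm, Real.rpow_mul hs, Real.rpow_natCast]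
  have h2 : 1 + s ^ 2 ≤ (1 + 1 / t) * Real.exp (t * s ^ 2) := by
    have h3 := Real.add_one_le_exp (t * s ^ 2)
    have h4 : 1 + s ^ 2 ≤ (1 + 1 / t) * (t * s ^ 2 + 1) := by
      have : (1 + 1 / t) * (t * s ^ 2 + 1) = t * s ^ 2 + 1 + s ^ 2 + 1 / t := by field_simp; ring
      rw [this]
      have : 0 < 1 / t := by positivity
      nlinarith [mul_nonneg ht.le (sq_nonneg s)]
    exact h4.trans (by gcongr)
  have h5 : Real.exp (-t * s ^ 2) ^ 2 = Real.exp (-t * s ^ 2) * Real.exp (-t * s ^ 2) := sq _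
  have h6 : Real.exp (t * s ^ 2) * Real.exp (-t * s ^ 2) = 1 := by
    rw [← Real.exp_add]; simp
  calc heatSymbol α t s ^ 2 = Real.exp (-t * s ^ 2) * Real.exp (-t * s ^ 2) * (s ^ α) ^ 2 := by
        rw [heatSymbol, mul_pow, h5]
    _ ≤ Real.exp (-t * s ^ 2) * Real.exp (-t * s ^ 2) * ((1 + 1 / t) * Real.exp (t * s ^ 2)) := by
        gcongr; exact h1.trans h2
    _ = (1 + 1 / t) * Real.exp (-t * s ^ 2) * (Real.exp (t * s ^ 2) * Real.exp (-t * s ^ 2)) := by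
        ring
    _ = _ := by rw [h6, mul_one]

theorem heatSymbol_sq_le_const {α t s : ℝ} (hα0 : 0 ≤ α) (hα1 : α ≤ 1) (ht : 0 < t) (hs : 0 ≤ s) :
    heatSymbol α t s ^ 2 ≤ 1 + 1 / t := by
  refine (heatSymbol_sq_le hα0 hα1 ht hs).trans ?_
  refine mul_le_of_le_one_right (by positivity) (Real.exp_le_one_iff.2 ?_)
  nlinarith [mul_nonneg ht.le (sq_nonneg s)]

theorem heatSymbol_le_const {α t s : ℝ} (hα0 : 0 ≤ α) (hα1 : α ≤ 1) (ht : 0 < t) (hs : 0 ≤ s) :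
    ‖heatSymbol α t s‖ ≤ √(1 + 1 / t) := by
  rw [Real.norm_of_nonneg (heatSymbol_nonneg α t hs)]
  exact Real.le_sqrt_of_sq_le (heatSymbol_sq_le_const hα0 hα1 ht hs)

theorem enorm_sq_Lp_eq {X E : Type*} [MeasurableSpace X] [NormedAddCommGroup E] {μ : Measure X}
    (f : Lp E 2 μ) : ‖f‖ₑ ^ 2 = ∫⁻ x, ‖f x‖ₑ ^ 2 ∂μ := by
  rw [Lp.enorm_def, eLpNorm_eq_lintegral_rpow_enorm_toReal two_ne_zero ENNReal.ofNat_ne_top,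
    ← ENNReal.rpow_two, ← ENNReal.rpow_mul]
  simp

end Auxiliary

/-! ### Tempered distributions and the operators `D^{±α}` on `ℝ³` -/

section Distributions

variable {F : Type*} [NormedAddCommGroup F] [InnerProductSpace ℂ F]

/-- The symbol of `D = √(-Δ)`. -/
def freq (ξ : E3) : ℝ := 2 * Real.pi * ‖ξ‖

theorem freq_nonneg (ξ : E3) : 0 ≤ freq ξ := by unfold freq; positivity

theorem continuous_freq : Continuous freq := by unfold freq; fun_prop

theorem ae_freq_pos : ∀ᵐ ξ : E3, 0 < freq ξ := by
  have : ∀ᵐ ξ : E3, ξ ≠ 0 := by simp [ae_iff, measure_singleton]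
  filter_upwards [this] with ξ hξ
  have := norm_pos_iff.2 hξ
  unfold freq; positivity

theorem isRepresentedBy_hatFun {u : 𝓢'(E3, F)} (h : ∃ g : E3 → F, IsRepresentedBy (𝓕 u) g) :
    IsRepresentedBy (𝓕 u) (hatFun u) := by
  unfold hatFun
  rw [dif_pos h]
  exact h.choose_spec

theorem integrable_schwartz_smul_Lp (ψ : 𝓢(E3, ℂ)) {g : E3 → F} (hg : MemLp g 2 volume) :
    Integrable (fun ξ => ψ ξ • g ξ) :=
  memLp_one_iff_integrable.1 (hg.smul (ψ.memLp 2 volume))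

variable [CompleteSpace F]

theorem ae_eq_of_forall_schwartz {g g' : E3 → F} (hg : LocallyIntegrable g volume)
    (hg' : LocallyIntegrable g' volume)
    (h : ∀ ψ : 𝓢(E3, ℂ), ∫ ξ, ψ ξ • g ξ = ∫ ξ, ψ ξ • g' ξ) : g =ᵐ[volume] g' := by
  refine ae_eq_of_integral_contDiff_smul_eq hg hg' fun χ hχ hχc => ?_
  have hg₁ : HasCompactSupport (Complex.ofRealCLM ∘ χ) := hχc.comp_left rfl
  have hg₂ : ContDiff ℝ (⊤ : ℕ∞) (Complex.ofRealCLM ∘ χ) := Complex.ofRealCLM.contDiff.comp hχ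
  simpa using h (hg₁.toSchwartzMap hg₂)

/-- Makes the choice in `hatFun` immaterial up to a null set. -/
theorem IsRepresentedBy.ae_eq {u : 𝓢'(E3, F)} {g g' : E3 → F} (h : IsRepresentedBy u g)
    (h' : IsRepresentedBy u g') : g =ᵐ[volume] g' :=
  ae_eq_of_forall_schwartz h.1 h'.1 fun ψ => (h.2 ψ).2.symm.trans (h'.2 ψ).2

theorem fourier_isDpow {s : ℝ} {u : 𝓢'(E3, F)} {G : Lp F 2 (volume : Measure E3)}
    (h : IsDpow (-s) u G) :
    hatFun u =ᵐ[volume] fun ξ => freq ξ ^ s • ((𝓕 G : Lp F 2 (volume : Measure E3)) : E3 → F) ξ := by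
  filter_upwards [h.2, ae_freq_pos] with ξ h1 h2
  rw [h1, ← freq, smul_smul, ← Real.rpow_add h2]
  simp

theorem hdotNorm_eq_of_isDpow {s : ℝ} {u : 𝓢'(E3, F)} {G : Lp F 2 (volume : Measure E3)}
    (h : IsDpow s u G) : hdotNorm s u = ‖G‖ₑ := by
  have e : ‖G‖ₑ = ‖(𝓕 G : Lp F 2 (volume : Measure E3))‖ₑ := by
    rw [← ofReal_norm, ← ofReal_norm, Lp.norm_fourier_eq]
  rw [e, Lp.enorm_def]
  exact (eLpNorm_congr_ae h.2).symm

theorem exists_isDpow_of_memHdot {s : ℝ} {u : 𝓢'(E3, F)} (h : MemHdot s u) :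
    ∃ G, IsDpow s u G := by
  have hm : MemLp (fun ξ => (2 * Real.pi * ‖ξ‖) ^ s • hatFun u ξ) 2 (volume : Measure E3) := by
    refine ⟨?_, h.2⟩
    have h1 := (isRepresentedBy_hatFun h.1).1.aestronglyMeasurable
    have h2 : Measurable fun ξ : E3 => (2 * Real.pi * ‖ξ‖) ^ s := by fun_prop
    exact h2.aestronglyMeasurable.smul h1
  refine ⟨𝓕⁻ hm.toLp, h, ?_⟩
  rw [fourier_fourierInv_eq]
  exact hm.coeFn_toLp

/-- Every `G ∈ L²` is `D^{-α} u` for some `u`. -/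
theorem exists_isDpow {α : ℝ} (hα0 : 0 < α) (hα1 : α ≤ 1) (G : Lp F 2 (volume : Measure E3)) :
    ∃ u : 𝓢'(E3, F), IsDpow (-α) u G := by
  set H : Lp F 2 (volume : Measure E3) := 𝓕 G with hH
  have hc : Continuous fun ξ => freq ξ ^ α :=
    continuous_freq.rpow_const fun _ => Or.inr hα0.le
  -- The function `(2π|ξ|)^α 𝓕G` need not be in `L²`. Divided by `1 + |ξ|²` it is, so it defines a
  -- tempered distribution, and multiplying back by this polynomial stays within tempered
  -- distributions. The bound is `(2π|ξ|)^α ≤ 1 + 2π|ξ| ≤ (1 + 2π)(1 + |ξ|²)`.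
  have hm : MemLp (fun ξ => (freq ξ ^ α / (1 + ‖ξ‖ ^ 2)) • H ξ) 2 (volume : Measure E3) := by
    refine (Lp.memLp H).of_le_mul (c := 1 + 2 * Real.pi) ?_ (ae_of_all _ fun ξ => ?_)
    · have hq : Continuous fun ξ : E3 => 1 + ‖ξ‖ ^ 2 := by fun_prop
      exact (hc.div hq fun ξ => by positivity).aestronglyMeasurable.smul
        (Lp.aestronglyMeasurable H)
    · rw [norm_smul]
      gcongr
      rw [Real.norm_of_nonneg (by have := freq_nonneg ξ; positivity), div_le_iff₀ (by positivity)]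
      have h1 := rpow_le_one_add (freq_nonneg ξ) hα0.le hα1
      have h2 : ‖ξ‖ ≤ 1 + ‖ξ‖ ^ 2 := by nlinarith [sq_nonneg (‖ξ‖ - 1)]
      have := Real.pi_pos
      unfold freq at h1 ⊢
      nlinarith [sq_nonneg ‖ξ‖, mul_le_mul_of_nonneg_left h2 this.le]
  have hgrow : (fun ξ : E3 => ((1 + ‖ξ‖ ^ 2 : ℝ) : ℂ)).HasTemperateGrowth := by fun_prop
  set D : 𝓢'(E3, F) := TemperedDistribution.smulLeftCLM F
    (fun ξ : E3 => ((1 + ‖ξ‖ ^ 2 : ℝ) : ℂ)) (hm.toLp : 𝓢'(E3, F)) with hD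
  have hDapply (ψ : 𝓢(E3, ℂ)) :
      Integrable (fun ξ => ψ ξ • freq ξ ^ α • H ξ) ∧ D ψ = ∫ ξ, ψ ξ • freq ξ ^ α • H ξ := by
    set ψ' := SchwartzMap.smulLeftCLM ℂ (fun ξ : E3 => ((1 + ‖ξ‖ ^ 2 : ℝ) : ℂ)) ψ with hψ'
    have e : (fun ξ => ψ' ξ • (freq ξ ^ α / (1 + ‖ξ‖ ^ 2)) • H ξ) =
        fun ξ => ψ ξ • freq ξ ^ α • H ξ := by
      funext ξ
      rw [hψ', SchwartzMap.smulLeftCLM_apply_apply hgrow]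
      simp only [← Complex.coe_smul, smul_smul, smul_eq_mul]
      congr 1
      have : ((1 + ‖ξ‖ ^ 2 : ℝ) : ℂ) ≠ 0 := by
        exact_mod_cast (show (1 + ‖ξ‖ ^ 2 : ℝ) ≠ 0 by positivity)
      push_cast at this ⊢
      field_simp
    refine ⟨e ▸ integrable_schwartz_smul_Lp ψ' hm, ?_⟩
    rw [hD, TemperedDistribution.smulLeftCLM_apply_apply, Lp.toTemperedDistribution_apply, ← e]
    exact integral_congr_ae (hm.coeFn_toLp.mono fun ξ hξ => by simp only [hξ, hψ'])
  have hrep : IsRepresentedBy (𝓕 (𝓕⁻ D : 𝓢'(E3, F))) fun ξ => freq ξ ^ α • H ξ := by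
    rw [fourier_fourierInv_eq]
    refine ⟨?_, hDapply⟩
    have h1 : LocallyIntegrable (H : E3 → F) volume := (Lp.memLp H).locallyIntegrable one_le_two
    rw [← locallyIntegrableOn_univ] at h1 ⊢
    exact h1.continuousOn_smul isOpen_univ.isLocallyClosed hc.continuousOn
  have hhat := (isRepresentedBy_hatFun ⟨_, hrep⟩).ae_eq hrep
  have hD2 : (H : E3 → F) =ᵐ[volume]
      fun ξ => (2 * Real.pi * ‖ξ‖) ^ (-α) • hatFun (𝓕⁻ D : 𝓢'(E3, F)) ξ := by
    filter_upwards [hhat, ae_freq_pos] with ξ h1 h2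
    rw [h1, ← freq, smul_smul, ← Real.rpow_add h2]
    simp
  refine ⟨𝓕⁻ D, ⟨⟨_, hrep⟩, ?_⟩, hD2⟩
  rw [hdotNorm, ← eLpNorm_congr_ae hD2]
  exact (Lp.memLp H).2

theorem heat_eq_of_isDpow {α t : ℝ} {u : 𝓢'(E3, F)} {G : Lp F 2 (volume : Measure E3)}
    (h : IsDpow (-α) u G) (x : E3) :
    heat t u x = 𝓕⁻ (fun ξ => heatSymbol α t (freq ξ) •
      ((𝓕 G : Lp F 2 (volume : Measure E3)) : E3 → F) ξ) x := by
  refine Real.fourierInv_congr_ae ?_ x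
  filter_upwards [fourier_isDpow h] with ξ hξ
  rw [hξ, smul_smul]; rfl

end Distributions

/-! ### The heat evolution of `L²` data: point evaluation and Plancherel -/

section FourierL2

variable {F : Type*} [NormedAddCommGroup F] [InnerProductSpace ℂ F]

theorem integrable_exp_neg_mul_freq_sq {t : ℝ} (ht : 0 < t) :
    Integrable fun ξ : E3 => Real.exp (-t * freq ξ ^ 2) := by
  have h := (GaussianFourier.integrable_cexp_neg_mul_sq_norm_add (V := E3)
    (b := ((t * (2 * Real.pi) ^ 2 : ℝ) : ℂ)) (by rw [Complex.ofReal_re]; positivity) 0 0).norm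
  refine h.congr (ae_of_all _ fun ξ => ?_)
  simp only [Complex.norm_exp, freq]
  congr 1
  simp only [zero_mul, add_zero]
  rw [← Complex.ofReal_pow, ← Complex.ofReal_neg, ← Complex.ofReal_mul, Complex.ofReal_re]
  ring

theorem memLp_heatSymbol {α t : ℝ} (hα0 : 0 ≤ α) (hα1 : α ≤ 1) (ht : 0 < t) :
    MemLp (fun ξ : E3 => heatSymbol α t (freq ξ)) 2 volume := by
  have hm : Measurable fun ξ : E3 => heatSymbol α t (freq ξ) :=
    (measurable_heatSymbol α).comp (measurable_const.prodMk continuous_freq.measurable)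
  rw [memLp_two_iff_integrable_sq hm.aestronglyMeasurable]
  refine ((integrable_exp_neg_mul_freq_sq ht).const_mul (1 + 1 / t)).mono'
    (hm.pow_const 2).aestronglyMeasurable (ae_of_all _ fun ξ => ?_)
  rw [Real.norm_of_nonneg (sq_nonneg _)]
  exact heatSymbol_sq_le hα0 hα1 ht (freq_nonneg ξ)

theorem integrable_heatSymbol_smul {α t : ℝ} (hα0 : 0 ≤ α) (hα1 : α ≤ 1) (ht : 0 < t)
    {g : E3 → F} (hg : MemLp g 2 volume) :
    Integrable fun ξ : E3 => heatSymbol α t (freq ξ) • g ξ := by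
  have h := memLp_one_iff_integrable.1
    (hg.smul (r := 1) (memLp_heatSymbol hα0 hα1 ht).ofReal (𝕜 := ℂ))
  exact h.congr (ae_of_all _ fun ξ => Complex.coe_smul _ _)

theorem memLp_heatSymbol_smul {α t : ℝ} (hα0 : 0 ≤ α) (hα1 : α ≤ 1) (ht : 0 < t)
    {g : E3 → F} (hg : MemLp g 2 volume) :
    MemLp (fun ξ : E3 => heatSymbol α t (freq ξ) • g ξ) 2 volume := by
  refine hg.of_le_mul (c := √(1 + 1 / t))
    ((memLp_heatSymbol hα0 hα1 ht).1.smul hg.1) (ae_of_all _ fun ξ => ?_)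
  rw [norm_smul]
  gcongr
  exact heatSymbol_le_const hα0 hα1 ht (freq_nonneg ξ)

theorem continuous_fourierInv {g : E3 → F} (hg : Integrable g) : Continuous (𝓕⁻ g) :=
  VectorFourier.fourierIntegral_continuous Real.continuous_fourierChar
    (L := -innerₗ E3) (continuous_inner (𝕜 := ℝ) (E := E3)).neg hg

variable [CompleteSpace F]

/-- `G ↦ e^{tΔ} D^α G (x)` as a continuous functional on `L²`, for positive time. -/
theorem exists_clm_heat_eval {α t : ℝ} (hα0 : 0 ≤ α) (hα1 : α ≤ 1) (ht : 0 < t) (x : E3) :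
    ∃ L : Lp F 2 (volume : Measure E3) →L[ℂ] F, ∀ G, L G =
      𝓕⁻ (fun ξ => heatSymbol α t (freq ξ) •
        ((𝓕 G : Lp F 2 (volume : Measure E3)) : E3 → F) ξ) x := by
  -- The evaluation is the pairing of `𝓕 G` with this `L²` kernel, hence continuous by Hölder and
  -- Plancherel.
  have hk : MemLp (fun ξ : E3 => (Real.fourierChar (inner ℝ ξ x) : ℂ) *
      (heatSymbol α t (freq ξ) : ℂ)) 2 volume := by
    refine (memLp_heatSymbol hα0 hα1 ht).of_le ?_ (ae_of_all _ fun ξ => ?_)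
    · refine AEStronglyMeasurable.mul ?_ ?_
      · have : Continuous fun ξ : E3 => (Real.fourierChar (inner ℝ ξ x) : ℂ) :=
          continuous_subtype_val.comp (Real.continuous_fourierChar.comp (by fun_prop))
        exact this.aestronglyMeasurable
      · exact Complex.continuous_ofReal.comp_aestronglyMeasurable (memLp_heatSymbol hα0 hα1 ht).1
    · rw [norm_mul, Circle.norm_coe, one_mul, Complex.norm_real]
  refine ⟨((ContinuousLinearMap.lsmul ℂ ℂ (E := F)).lpPairing volume 2 2 hk.toLp).comp
    (Lp.fourierTransformₗᵢ E3 F).toContinuousLinearEquiv.toContinuousLinearMap, fun G => ?_⟩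
  change (ContinuousLinearMap.lsmul ℂ ℂ (E := F)).lpPairing volume 2 2 hk.toLp (𝓕 G) = _
  rw [ContinuousLinearMap.lpPairing_eq_integral, Real.fourierInv_eq]
  refine integral_congr_ae (hk.coeFn_toLp.mono fun ξ hξ => ?_)
  simp only [hξ, ContinuousLinearMap.lsmul_apply]
  rw [← smul_smul, Complex.coe_smul, Circle.smul_def]

theorem integral_schwartz_smul_fourierInv (ψ : 𝓢(E3, ℂ)) {g : E3 → F} (hg : Integrable g) :
    ∫ ξ, ψ ξ • 𝓕⁻ g ξ = ∫ ξ, (𝓕⁻ ψ : 𝓢(E3, ℂ)) ξ • g ξ := by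
  have h := VectorFourier.integral_bilin_fourierIntegral_eq_flip (e := Real.fourierChar)
    (μ := volume) (ν := volume) (L := -innerₗ E3) (f := (ψ : E3 → ℂ)) (g := g)
    (ContinuousLinearMap.lsmul ℂ ℂ (E := F)) Real.continuous_fourierChar
    (continuous_inner (𝕜 := ℝ) (E := E3)).neg ψ.integrable hg
  have hflip : (-innerₗ E3).flip = -innerₗ E3 := by
    ext a b; simp [real_inner_comm]
  rw [hflip] at h
  rw [SchwartzMap.fourierInv_coe]
  exact h.symm

/-- Plancherel's theorem for integrable square integrable functions. -/
theorem lintegral_enorm_fourierInv_sq {g : E3 → F} (hg1 : Integrable g) (hg2 : MemLp g 2 volume) :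
    ∫⁻ x, ‖𝓕⁻ g x‖ₑ ^ 2 = ∫⁻ x, ‖g x‖ₑ ^ 2 := by
  set V : Lp F 2 (volume : Measure E3) := 𝓕⁻ hg2.toLp with hV
  -- The pointwise integral and the `L²` extension of the inverse transform agree because they have
  -- the same pairings with Schwartz functions.
  have hae : 𝓕⁻ g =ᵐ[volume] V := by
    refine ae_eq_of_forall_schwartz (continuous_fourierInv hg1).locallyIntegrable
      ((Lp.memLp V).locallyIntegrable one_le_two) fun ψ => ?_
    rw [integral_schwartz_smul_fourierInv ψ hg1]
    have h1 := congrArg (fun T : 𝓢'(E3, F) => T ψ)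
      (Lp.fourierInv_toTemperedDistribution_eq hg2.toLp)
    simp only [TemperedDistribution.fourierInv_apply, Lp.toTemperedDistribution_apply] at h1
    rw [← hV] at h1
    rw [← h1]
    exact integral_congr_ae (hg2.coeFn_toLp.mono fun ξ hξ => by simp only [hξ])
  have e : ‖V‖ₑ = ‖hg2.toLp‖ₑ := by
    rw [← ofReal_norm, ← ofReal_norm, ← Lp.norm_fourier_eq, hV, fourier_fourierInv_eq]
  calc ∫⁻ x, ‖𝓕⁻ g x‖ₑ ^ 2 = ∫⁻ x, ‖V x‖ₑ ^ 2 :=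
        lintegral_congr_ae (hae.mono fun x hx => by simp only [hx])
    _ = ∫⁻ x, ‖hg2.toLp g x‖ₑ ^ 2 := by rw [← enorm_sq_Lp_eq, ← enorm_sq_Lp_eq, e]
    _ = _ := lintegral_congr_ae (hg2.coeFn_toLp.mono fun x hx => by simp only [hx])

end FourierL2

/-! ### Bounded overlap of the frequency cut-offs -/

section Cutoff

/-- The lattice points whose unit scale cube contains `ξ`. -/
def nearbyPoints (ξ : E3) : Finset Z3 :=
  Fintype.piFinset fun i => Finset.Icc ⌈ξ i - 1⌉ ⌊ξ i + 1⌋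

/-- An interval of length `2` contains at most three integers, and `27 = 3³`. -/
theorem card_nearbyPoints_le (ξ : E3) : (nearbyPoints ξ).card ≤ 27 := by
  rw [nearbyPoints, Fintype.card_piFinset, Fin.prod_univ_three]
  have h (i : Fin 3) : (Finset.Icc ⌈ξ i - 1⌉ ⌊ξ i + 1⌋).card ≤ 3 := by
    rw [Int.card_Icc]
    have h1 := Int.floor_le (ξ i + 1)
    have h2 := Int.le_ceil (ξ i - 1)
    have h3 : ((⌊ξ i + 1⌋ - ⌈ξ i - 1⌉ : ℤ) : ℝ) ≤ (2 : ℤ) := by push_cast; linarith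
    have h4 := Int.cast_le.1 h3
    omega
  calc _ ≤ 3 * 3 * 3 := Nat.mul_le_mul (Nat.mul_le_mul (h 0) (h 1)) (h 2)
    _ = 27 := rfl

@[simp] theorem latticePoint_apply (n : Z3) (i : Fin 3) : latticePoint n i = n i := rfl

variable {φ : E3 → ℝ}

theorem IsCutoff.abs_le_one_of_ne_zero (hφ : IsCutoff φ) {ξ : E3} (h : φ ξ ≠ 0) (i : Fin 3) :
    |ξ i| ≤ 1 := by
  by_contra hi
  refine h (hφ.eq_zero ξ fun hall => hi (abs_le.2 (hall i)))

theorem IsCutoff.mem_nearbyPoints (hφ : IsCutoff φ) {ξ : E3} {n : Z3}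
    (h : φ (ξ - latticePoint n) ≠ 0) : n ∈ nearbyPoints ξ := by
  rw [nearbyPoints, Fintype.mem_piFinset]
  intro i
  have := abs_le.1 (hφ.abs_le_one_of_ne_zero h i)
  simp only [PiLp.sub_apply, latticePoint_apply] at this
  rw [Finset.mem_Icc, Int.ceil_le, Int.le_floor]
  constructor <;> linarith

/-- The left side is the term `n = 0`. This bounds the normalized cut-off by `1` with no need for a
lower bound on the denominator. -/
theorem IsCutoff.le_tsum (hφ : IsCutoff φ) (ξ : E3) : φ ξ ≤ ∑' n : Z3, φ (ξ - latticePoint n) := by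
  have hs : Summable fun n : Z3 => φ (ξ - latticePoint n) :=
    summable_of_ne_finset_zero (s := nearbyPoints ξ) fun n hn => by
      by_contra h; exact hn (hφ.mem_nearbyPoints h)
  have h0 : latticePoint 0 = 0 := by ext i; simp
  simpa [h0] using hs.le_tsum 0 fun n _ => hφ.nonneg _

theorem IsCutoff.normalizedCutoff_nonneg (hφ : IsCutoff φ) (ξ : E3) : 0 ≤ normalizedCutoff φ ξ :=
  div_nonneg (hφ.nonneg _) (tsum_nonneg fun _ => hφ.nonneg _)

theorem IsCutoff.normalizedCutoff_le_one (hφ : IsCutoff φ) (ξ : E3) : normalizedCutoff φ ξ ≤ 1 :=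
  div_le_one_of_le₀ (hφ.le_tsum ξ) (tsum_nonneg fun _ => hφ.nonneg _)

theorem IsCutoff.measurable_normalizedCutoff (hφ : IsCutoff φ) :
    Measurable (normalizedCutoff φ) := by
  have h : Measurable φ := hφ.smooth.continuous.measurable
  exact h.div (Measurable.tsum fun n => h.comp (measurable_id.sub_const _))

/-- The symbol of the frequency localization around `n`. -/
def wienerSymbol (φ : E3 → ℝ) (n : Z3) (ξ : E3) : ℝ := normalizedCutoff φ (ξ - latticePoint n)

theorem IsCutoff.measurable_wienerSymbol (hφ : IsCutoff φ) (n : Z3) :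
    Measurable (wienerSymbol φ n) :=
  hφ.measurable_normalizedCutoff.comp (measurable_id.sub_const _)

theorem IsCutoff.abs_wienerSymbol_le_one (hφ : IsCutoff φ) (n : Z3) (ξ : E3) :
    |wienerSymbol φ n ξ| ≤ 1 := by
  rw [wienerSymbol, abs_of_nonneg (hφ.normalizedCutoff_nonneg _)]
  exact hφ.normalizedCutoff_le_one _

theorem IsCutoff.wienerSymbol_eq_zero (hφ : IsCutoff φ) {n : Z3} {ξ : E3}
    (h : n ∉ nearbyPoints ξ) : wienerSymbol φ n ξ = 0 := by
  have : φ (ξ - latticePoint n) = 0 := by by_contra h'; exact h (hφ.mem_nearbyPoints h')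
  rw [wienerSymbol, normalizedCutoff, this, zero_div]

/-- The cube `[-1,1]³` lies in the ball of radius `√3 ≤ 2`. -/
theorem IsCutoff.wienerSymbol_eq_zero_of_notMem (hφ : IsCutoff φ) {n : Z3} {ξ : E3}
    (h : ξ ∉ Metric.closedBall (latticePoint n) 2) : wienerSymbol φ n ξ = 0 := by
  have : φ (ξ - latticePoint n) = 0 := by
    by_contra h'
    refine h ?_
    rw [mem_closedBall_iff_norm]
    refine (sq_le_sq₀ (norm_nonneg _) zero_le_two).1 ?_
    rw [EuclideanSpace.norm_sq_eq, Fin.sum_univ_three]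
    have hi (i : Fin 3) : ‖(ξ - latticePoint n) i‖ ^ 2 ≤ 1 := by
      have := hφ.abs_le_one_of_ne_zero h' i
      rw [Real.norm_eq_abs]
      exact pow_le_one₀ (abs_nonneg _) this
    linarith [hi 0, hi 1, hi 2]
  rw [wienerSymbol, normalizedCutoff, this, zero_div]

/-- Cauchy–Schwarz over the at most `27` indices whose symbol does not vanish at `ξ`. -/
theorem IsCutoff.sq_sum_wienerSymbol_le (hφ : IsCutoff φ) (S : Finset Z3) (c : Z3 → ℝ) (ξ : E3) :
    (∑ n ∈ S, c n * wienerSymbol φ n ξ) ^ 2 ≤ 27 * ∑ n ∈ S, c n ^ 2 * wienerSymbol φ n ξ ^ 2 := by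
  classical
  have e : ∑ n ∈ S, c n * wienerSymbol φ n ξ =
      ∑ n ∈ S ∩ nearbyPoints ξ, c n * wienerSymbol φ n ξ := by
    refine (Finset.sum_subset Finset.inter_subset_left fun n hn hn' => ?_).symm
    rw [hφ.wienerSymbol_eq_zero fun h => hn' (Finset.mem_inter.2 ⟨hn, h⟩), mul_zero]
  have hcard : ((S ∩ nearbyPoints ξ).card : ℝ) ≤ 27 := by
    exact_mod_cast (Finset.card_le_card Finset.inter_subset_right).trans (card_nearbyPoints_le ξ)
  rw [e]
  calc _ ≤ ((S ∩ nearbyPoints ξ).card : ℝ) *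
        ∑ n ∈ S ∩ nearbyPoints ξ, (c n * wienerSymbol φ n ξ) ^ 2 := sq_sum_le_card_mul_sum_sq
    _ ≤ 27 * ∑ n ∈ S, (c n * wienerSymbol φ n ξ) ^ 2 := by
        refine mul_le_mul hcard ?_ (Finset.sum_nonneg fun _ _ => sq_nonneg _) (by norm_num)
        exact Finset.sum_le_sum_of_subset_of_nonneg Finset.inter_subset_left
          fun _ _ _ => sq_nonneg _
    _ = _ := by simp_rw [mul_pow]

theorem IsCutoff.tsum_enorm_wienerSymbol_sq_le (hφ : IsCutoff φ) (ξ : E3) :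
    ∑' n : Z3, ‖wienerSymbol φ n ξ‖ₑ ^ 2 ≤ 27 := by
  rw [tsum_eq_sum (s := nearbyPoints ξ)
    fun n hn => by rw [hφ.wienerSymbol_eq_zero hn]; simp]
  refine (Finset.sum_le_card_nsmul _ _ 1 fun n _ => ?_).trans ?_
  · refine pow_le_one₀ zero_le ?_
    rw [← ofReal_norm, ← ENNReal.ofReal_one]
    exact ENNReal.ofReal_le_ofReal (hφ.abs_wienerSymbol_le_one n ξ)
  · rw [nsmul_one]
    exact_mod_cast card_nearbyPoints_le ξ

end Cutoff

/-! ### Almost orthogonality of the frequency pieces of an `L²` function -/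

section WienerPieces

theorem enorm_sq_eq_ofReal {E : Type*} [NormedAddCommGroup E] (x : E) :
    ‖x‖ₑ ^ 2 = ENNReal.ofReal (‖x‖ ^ 2) := by
  rw [← ofReal_norm, ENNReal.ofReal_pow (norm_nonneg _)]

variable {F : Type*} [NormedAddCommGroup F] [InnerProductSpace ℂ F] [CompleteSpace F]
  {φ : E3 → ℝ}

/-- The symbol is bounded by `1`, so the default value `0` in `fourierMultiplier` never occurs. -/
theorem IsCutoff.fourier_wienerPiece (hφ : IsCutoff φ) (n : Z3)
    (G : Lp F 2 (volume : Measure E3)) :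
    (𝓕 (wienerPiece φ n G) : Lp F 2 (volume : Measure E3)) =ᵐ[volume]
      fun ξ => wienerSymbol φ n ξ • ((𝓕 G : Lp F 2 (volume : Measure E3)) : E3 → F) ξ := by
  have h : MemLp (fun ξ => normalizedCutoff φ (ξ - latticePoint n) •
      ((𝓕 G : Lp F 2 (volume : Measure E3)) : E3 → F) ξ) 2 volume := by
    refine (Lp.memLp (𝓕 G : Lp F 2 (volume : Measure E3))).of_le
      ((hφ.measurable_wienerSymbol n).aestronglyMeasurable.smul (Lp.aestronglyMeasurable _))
      (ae_of_all _ fun ξ => ?_)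
    rw [norm_smul]
    exact mul_le_of_le_one_left (norm_nonneg _) (hφ.abs_wienerSymbol_le_one n ξ)
  rw [wienerPiece, fourierMultiplier, dif_pos h, fourier_fourierInv_eq]
  exact h.coeFn_toLp

theorem enorm_fourier_eq (G : Lp F 2 (volume : Measure E3)) :
    ‖(𝓕 G : Lp F 2 (volume : Measure E3))‖ₑ = ‖G‖ₑ := by
  rw [← ofReal_norm, ← ofReal_norm, Lp.norm_fourier_eq]

theorem enorm_sq_eq_lintegral_fourier (G : Lp F 2 (volume : Measure E3)) :
    ‖G‖ₑ ^ 2 = ∫⁻ ξ, ‖((𝓕 G : Lp F 2 (volume : Measure E3)) : E3 → F) ξ‖ₑ ^ 2 := by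
  rw [← enorm_fourier_eq, enorm_sq_Lp_eq]

/-- The frequency localizations have bounded overlap, also with a weight. -/
theorem IsCutoff.tsum_lintegral_wienerPiece_le (hφ : IsCutoff φ)
    (G : Lp F 2 (volume : Measure E3)) {w : E3 → ℝ≥0∞} (hw : Measurable w) :
    ∑' n, ∫⁻ ξ, w ξ * ‖((𝓕 (wienerPiece φ n G) : Lp F 2 (volume : Measure E3)) : E3 → F) ξ‖ₑ ^ 2 ≤
      27 * ∫⁻ ξ, w ξ * ‖((𝓕 G : Lp F 2 (volume : Measure E3)) : E3 → F) ξ‖ₑ ^ 2 := by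
  set H : Lp F 2 (volume : Measure E3) := 𝓕 G with hH
  have hHm : AEMeasurable (fun ξ => ‖H ξ‖ₑ ^ 2) volume :=
    (Lp.aestronglyMeasurable H).enorm.pow_const 2
  have e (n : Z3) : ∫⁻ ξ, w ξ * ‖((𝓕 (wienerPiece φ n G) : Lp F 2 (volume : Measure E3)) :
      E3 → F) ξ‖ₑ ^ 2 = ∫⁻ ξ, ‖wienerSymbol φ n ξ‖ₑ ^ 2 * (w ξ * ‖H ξ‖ₑ ^ 2) := by
    refine lintegral_congr_ae ((hφ.fourier_wienerPiece n G).mono fun ξ hξ => ?_)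
    simp only [hξ, enorm_smul, mul_pow]
    ring
  simp_rw [e]
  have hswap := lintegral_tsum (μ := volume)
    (f := fun n ξ => ‖wienerSymbol φ n ξ‖ₑ ^ 2 * (w ξ * ‖H ξ‖ₑ ^ 2)) fun n =>
      ((hφ.measurable_wienerSymbol n).enorm.pow_const 2).aemeasurable.mul (hw.aemeasurable.mul hHm)
  rw [← hswap, ← lintegral_const_mul' _ _ (by simp)]
  refine lintegral_mono fun ξ => ?_
  rw [ENNReal.tsum_mul_right]
  gcongr
  exact hφ.tsum_enorm_wienerSymbol_sq_le ξ

theorem IsCutoff.summable_norm_wienerPiece_sq (hφ : IsCutoff φ)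
    (G : Lp F 2 (volume : Measure E3)) : Summable fun n => ‖wienerPiece φ n G‖ ^ 2 := by
  have h := hφ.tsum_lintegral_wienerPiece_le G (w := fun _ => 1) measurable_const
  simp only [one_mul, ← enorm_sq_eq_lintegral_fourier] at h
  have hne : ∑' n, ‖wienerPiece φ n G‖ₑ ^ 2 ≠ ∞ :=
    ne_top_of_le_ne_top (ENNReal.mul_ne_top (by simp) (by simp)) h
  refine (ENNReal.summable_toReal hne).congr fun n => ?_
  simp

/-- Integrate the pointwise overlap bound on the Fourier side. This replaces orthogonality in the
convergence of the random series, with `K = 27`. -/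
theorem IsCutoff.norm_sum_wienerPiece_sq_le (hφ : IsCutoff φ) (G : Lp F 2 (volume : Measure E3))
    (S : Finset Z3) (c : Z3 → ℝ) :
    ‖∑ n ∈ S, (c n : ℂ) • wienerPiece φ n G‖ ^ 2 ≤
      27 * ∑ n ∈ S, c n ^ 2 * ‖wienerPiece φ n G‖ ^ 2 := by
  set H : Lp F 2 (volume : Measure E3) := 𝓕 G with hH
  have hsum : (𝓕 (∑ n ∈ S, (c n : ℂ) • wienerPiece φ n G) : Lp F 2 (volume : Measure E3)) =
      ∑ n ∈ S, (c n : ℂ) • (𝓕 (wienerPiece φ n G) : Lp F 2 (volume : Measure E3)) := by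
    change Lp.fourierTransformₗᵢ E3 F _ = ∑ n ∈ S, (c n : ℂ) • Lp.fourierTransformₗᵢ E3 F _
    simp only [map_sum, map_smul]
  have hpieces : ∀ᵐ ξ, ∀ n, ((c n : ℂ) • (𝓕 (wienerPiece φ n G) : Lp F 2 (volume : Measure E3)) :
      Lp F 2 (volume : Measure E3)) ξ = (c n * wienerSymbol φ n ξ) • H ξ := by
    refine ae_all_iff.2 fun n => ?_
    filter_upwards [Lp.coeFn_smul (c n : ℂ) (𝓕 (wienerPiece φ n G) : Lp F 2 (volume : Measure E3)),
      hφ.fourier_wienerPiece n G] with ξ h1 h2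
    rw [h1, Pi.smul_apply, h2, Complex.coe_smul, smul_smul]
  have hae : ((𝓕 (∑ n ∈ S, (c n : ℂ) • wienerPiece φ n G) : Lp F 2 (volume : Measure E3)) :
      E3 → F) =ᵐ[volume] fun ξ => (∑ n ∈ S, c n * wienerSymbol φ n ξ) • H ξ := by
    rw [hsum]
    filter_upwards [Lp.coeFn_fun_finsetSum S (fun n => (c n : ℂ) •
      (𝓕 (wienerPiece φ n G) : Lp F 2 (volume : Measure E3))), hpieces] with ξ h1 h2
    rw [h1, Finset.sum_smul]
    exact Finset.sum_congr rfl fun n _ => h2 n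
  have key : ‖∑ n ∈ S, (c n : ℂ) • wienerPiece φ n G‖ₑ ^ 2 ≤
      ∑ n ∈ S, ENNReal.ofReal (27 * c n ^ 2) * ‖wienerPiece φ n G‖ₑ ^ 2 := by
    have hHm : AEMeasurable (fun ξ => ‖H ξ‖ₑ ^ 2) volume :=
      (Lp.aestronglyMeasurable H).enorm.pow_const 2
    calc _ = ∫⁻ ξ, ‖(∑ n ∈ S, c n * wienerSymbol φ n ξ) • H ξ‖ₑ ^ 2 := by
          rw [enorm_sq_eq_lintegral_fourier]
          exact lintegral_congr_ae (hae.mono fun ξ hξ => by simp only [hξ])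
      _ ≤ ∫⁻ ξ, ∑ n ∈ S, ENNReal.ofReal (27 * c n ^ 2) *
            (‖wienerSymbol φ n ξ‖ₑ ^ 2 * ‖H ξ‖ₑ ^ 2) := by
          refine lintegral_mono fun ξ => ?_
          simp only [← mul_assoc]
          rw [← Finset.sum_mul, enorm_smul, mul_pow]
          gcongr
          simp only [enorm_sq_eq_ofReal, Real.norm_eq_abs, sq_abs]
          have e (n : Z3) : ENNReal.ofReal (27 * c n ^ 2) * ENNReal.ofReal (wienerSymbol φ n ξ ^ 2)
              = ENNReal.ofReal (27 * c n ^ 2 * wienerSymbol φ n ξ ^ 2) :=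
            (ENNReal.ofReal_mul (by positivity)).symm
          simp only [e]
          rw [← ENNReal.ofReal_sum_of_nonneg fun n _ => by positivity]
          refine ENNReal.ofReal_le_ofReal ((hφ.sq_sum_wienerSymbol_le S c ξ).trans (le_of_eq ?_))
          rw [Finset.mul_sum]
          exact Finset.sum_congr rfl fun n _ => by ring
      _ = ∑ n ∈ S, ENNReal.ofReal (27 * c n ^ 2) *
            ∫⁻ ξ, ‖wienerSymbol φ n ξ‖ₑ ^ 2 * ‖H ξ‖ₑ ^ 2 := by
          have hm (n : Z3) : AEMeasurable (fun ξ => ‖wienerSymbol φ n ξ‖ₑ ^ 2 * ‖H ξ‖ₑ ^ 2)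
              volume := ((hφ.measurable_wienerSymbol n).enorm.pow_const 2).aemeasurable.mul hHm
          rw [lintegral_finsetSum' _ fun n _ => (hm n).const_mul _]
          exact Finset.sum_congr rfl fun n _ => lintegral_const_mul'' _ (hm n)
      _ = _ := by
          refine Finset.sum_congr rfl fun n _ => ?_
          rw [enorm_sq_eq_lintegral_fourier]
          congr 1
          refine lintegral_congr_ae ((hφ.fourier_wienerPiece n G).mono fun ξ hξ => ?_)
          simp only [hξ, enorm_smul, mul_pow, hH]
  simp only [enorm_sq_eq_ofReal] at key
  have e (n : Z3) : ENNReal.ofReal (27 * c n ^ 2) * ENNReal.ofReal (‖wienerPiece φ n G‖ ^ 2)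
      = ENNReal.ofReal (27 * c n ^ 2 * ‖wienerPiece φ n G‖ ^ 2) :=
    (ENNReal.ofReal_mul (by positivity)).symm
  simp only [e] at key
  rw [← ENNReal.ofReal_sum_of_nonneg fun n _ => by positivity,
    ENNReal.ofReal_le_ofReal_iff (Finset.sum_nonneg fun n _ => by positivity)] at key
  refine key.trans (le_of_eq ?_)
  rw [Finset.mul_sum]
  exact Finset.sum_congr rfl fun n _ => by ring

end WienerPieces

/-! ### Uniform and averaged bounds for the square function on `ℝ³` -/

section HeatOfPieces

variable {F : Type*} [NormedAddCommGroup F] [InnerProductSpace ℂ F]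

/-- Bernstein's inequality: the inverse Fourier transform of a function supported in a set of
finite measure is bounded by its `L²` norm. -/
theorem enorm_fourierInv_sq_le {g : E3 → F} (hg : AEStronglyMeasurable g volume) {B : Set E3}
    (hB : MeasurableSet B) (h0 : ∀ᵐ ξ, ξ ∉ B → g ξ = 0) (x : E3) :
    ‖𝓕⁻ g x‖ₑ ^ 2 ≤ volume B * ∫⁻ ξ, ‖g ξ‖ₑ ^ 2 := by
  have h1 : ‖𝓕⁻ g x‖ₑ ≤ ∫⁻ ξ in B, ‖g ξ‖ₑ := by
    rw [Real.fourierInv_eq]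
    refine (enorm_integral_le_lintegral_enorm _).trans (le_of_eq ?_)
    rw [← lintegral_indicator hB]
    refine lintegral_congr_ae (h0.mono fun ξ hξ => ?_)
    by_cases hmem : ξ ∈ B
    · simp only [Set.indicator_of_mem hmem]
      rw [← ofReal_norm, Circle.norm_smul, ofReal_norm]
    · simp [Set.indicator_of_notMem hmem, hξ hmem]
  have h2 : ∫⁻ ξ in B, ‖g ξ‖ₑ ≤ (volume B) ^ (1 / 2 : ℝ) * (∫⁻ ξ, ‖g ξ‖ₑ ^ 2) ^ (1 / 2 : ℝ) := by
    have := ENNReal.lintegral_mul_le_Lp_mul_Lq (volume.restrict B) Real.HolderConjugate.two_two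
      (f := fun _ => 1) (g := fun ξ => ‖g ξ‖ₑ) aemeasurable_const hg.enorm.restrict
    simp only [Pi.mul_apply, one_mul, one_pow, lintegral_const, Measure.restrict_apply_univ,
      ENNReal.rpow_two] at this
    refine this.trans ?_
    gcongr
    exact Measure.restrict_le_self
  calc ‖𝓕⁻ g x‖ₑ ^ 2 ≤
        ((volume B) ^ (1 / 2 : ℝ) * (∫⁻ ξ, ‖g ξ‖ₑ ^ 2) ^ (1 / 2 : ℝ)) ^ 2 := by
        gcongr; exact h1.trans h2
    _ = _ := by
        rw [← ENNReal.mul_rpow_of_nonneg _ _ (by norm_num), ← ENNReal.rpow_two, ← ENNReal.rpow_mul]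
        norm_num

theorem stronglyMeasurable_fourierInv_heatSymbol {g : E3 → F} (hg : StronglyMeasurable g) (α : ℝ) :
    StronglyMeasurable fun z : ℝ × E3 => 𝓕⁻ (fun ξ => heatSymbol α z.1 (freq ξ) • g ξ) z.2 := by
  simp only [Real.fourierInv_eq, Circle.smul_def]
  refine StronglyMeasurable.integral_prod_right' (f := fun y : (ℝ × E3) × E3 =>
    (Real.fourierChar (inner ℝ y.2 y.1.2) : ℂ) • heatSymbol α y.1.1 (freq y.2) • g y.2) ?_
  have hK : StronglyMeasurable fun y : (ℝ × E3) × E3 => heatSymbol α y.1.1 (freq y.2) :=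
    ((measurable_heatSymbol α).comp ((measurable_fst.comp measurable_fst).prodMk
      (continuous_freq.measurable.comp measurable_snd))).stronglyMeasurable
  refine StronglyMeasurable.smul ?_ (hK.smul (hg.comp_measurable measurable_snd))
  · have : Continuous fun y : (ℝ × E3) × E3 => (Real.fourierChar (inner ℝ y.2 y.1.2) : ℂ) :=
      continuous_subtype_val.comp (Real.continuous_fourierChar.comp (by fun_prop))
    exact this.stronglyMeasurable

variable [CompleteSpace F] {φ : E3 → ℝ}

/-- `e^{tΔ} D^α ψ(D - n) G`. -/
def heatPiece (α : ℝ) (φ : E3 → ℝ) (G : Lp F 2 (volume : Measure E3)) (n : Z3) (t : ℝ) (x : E3) :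
    F :=
  𝓕⁻ (fun ξ => heatSymbol α t (freq ξ) •
    ((𝓕 (wienerPiece φ n G) : Lp F 2 (volume : Measure E3)) : E3 → F) ξ) x

/-- The volume of the balls containing the unit scale frequency cubes, enlarged by `1`. -/
def cubeVolume : ℝ≥0∞ := volume (Metric.closedBall (0 : E3) 2) + 1

theorem cubeVolume_ne_top : cubeVolume ≠ ∞ :=
  ENNReal.add_ne_top.2 ⟨measure_closedBall_lt_top.ne, ENNReal.one_ne_top⟩

/-- Bounded overlap with the squared heat symbol as weight. The right side is an integral against
the spectral measure `|𝓕G|² dξ`, the form required by `lintegral_square_function_le`. -/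
theorem IsCutoff.tsum_lintegral_heatSymbol_le (hφ : IsCutoff φ) (α t : ℝ)
    (G : Lp F 2 (volume : Measure E3)) :
    ∑' n, ∫⁻ ξ, ‖heatSymbol α t (freq ξ) •
      ((𝓕 (wienerPiece φ n G) : Lp F 2 (volume : Measure E3)) : E3 → F) ξ‖ₑ ^ 2 ≤
    27 * ∫⁻ ξ, ENNReal.ofReal (heatSymbol α t (freq ξ)) ^ 2 ∂(volume.withDensity
      fun ξ => ‖((𝓕 G : Lp F 2 (volume : Measure E3)) : E3 → F) ξ‖ₑ ^ 2) := by
  have hm : Measurable fun ξ : E3 => ENNReal.ofReal (heatSymbol α t (freq ξ)) ^ 2 :=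
    ((measurable_heatSymbol α).comp
      (measurable_const.prodMk continuous_freq.measurable)).ennreal_ofReal.pow_const 2
  rw [lintegral_withDensity_eq_lintegral_mul₀
    ((Lp.aestronglyMeasurable _).enorm.pow_const 2) hm.aemeasurable]
  have h := hφ.tsum_lintegral_wienerPiece_le G hm
  have e (ξ : E3) : ‖heatSymbol α t (freq ξ)‖ₑ = ENNReal.ofReal (heatSymbol α t (freq ξ)) :=
    Real.enorm_of_nonneg (heatSymbol_nonneg _ _ (freq_nonneg ξ))
  simp only [enorm_smul, mul_pow, e]
  refine h.trans (le_of_eq ?_)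
  congr 1
  exact lintegral_congr fun ξ => mul_comm _ _

/-- Bernstein for each piece: its frequencies lie in a ball of radius `2`, whose volume does not
depend on the centre `n`. -/
theorem IsCutoff.tsum_enorm_heatPiece_sq_le (hφ : IsCutoff φ) (α t : ℝ)
    (G : Lp F 2 (volume : Measure E3)) (x : E3) :
    ∑' n, ‖heatPiece α φ G n t x‖ₑ ^ 2 ≤ 27 * cubeVolume *
      ∫⁻ ξ, ENNReal.ofReal (heatSymbol α t (freq ξ)) ^ 2 ∂(volume.withDensity
        fun ξ => ‖((𝓕 G : Lp F 2 (volume : Measure E3)) : E3 → F) ξ‖ₑ ^ 2) := by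
  have hm : Measurable fun ξ : E3 => heatSymbol α t (freq ξ) :=
    (measurable_heatSymbol α).comp (measurable_const.prodMk continuous_freq.measurable)
  have h (n : Z3) : ‖heatPiece α φ G n t x‖ₑ ^ 2 ≤ cubeVolume * ∫⁻ ξ, ‖heatSymbol α t (freq ξ) •
      ((𝓕 (wienerPiece φ n G) : Lp F 2 (volume : Measure E3)) : E3 → F) ξ‖ₑ ^ 2 := by
    refine (enorm_fourierInv_sq_le (B := Metric.closedBall (latticePoint n) 2)
      (g := fun ξ => heatSymbol α t (freq ξ) •
        ((𝓕 (wienerPiece φ n G) : Lp F 2 (volume : Measure E3)) : E3 → F) ξ)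
      (hm.aestronglyMeasurable.smul (Lp.aestronglyMeasurable _)) measurableSet_closedBall ?_
      x).trans ?_
    · filter_upwards [hφ.fourier_wienerPiece n G] with ξ h1 h2
      rw [h1, hφ.wienerSymbol_eq_zero_of_notMem h2, zero_smul, smul_zero]
    · gcongr
      rw [Measure.addHaar_closedBall_center]
      exact le_self_add
  calc _ ≤ ∑' n, cubeVolume * ∫⁻ ξ, ‖heatSymbol α t (freq ξ) •
      ((𝓕 (wienerPiece φ n G) : Lp F 2 (volume : Measure E3)) : E3 → F) ξ‖ₑ ^ 2 :=
        ENNReal.tsum_le_tsum h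
    _ = cubeVolume * ∑' n, ∫⁻ ξ, ‖heatSymbol α t (freq ξ) •
      ((𝓕 (wienerPiece φ n G) : Lp F 2 (volume : Measure E3)) : E3 → F) ξ‖ₑ ^ 2 :=
        ENNReal.tsum_mul_left
    _ ≤ _ := by
        rw [mul_comm 27, mul_assoc]
        gcongr
        exact hφ.tsum_lintegral_heatSymbol_le α t G

/-- Plancherel for each piece, then the overlap bound. -/
theorem IsCutoff.lintegral_tsum_enorm_heatPiece_sq_le (hφ : IsCutoff φ) {α t : ℝ} (hα0 : 0 ≤ α)
    (hα1 : α ≤ 1) (ht : 0 < t) (G : Lp F 2 (volume : Measure E3)) :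
    ∫⁻ x, ∑' n, ‖heatPiece α φ G n t x‖ₑ ^ 2 ≤ 27 * cubeVolume *
      ∫⁻ ξ, ENNReal.ofReal (heatSymbol α t (freq ξ)) ^ 2 ∂(volume.withDensity
        fun ξ => ‖((𝓕 G : Lp F 2 (volume : Measure E3)) : E3 → F) ξ‖ₑ ^ 2) := by
  have hint (n : Z3) := integrable_heatSymbol_smul hα0 hα1 ht
    (Lp.memLp (𝓕 (wienerPiece φ n G) : Lp F 2 (volume : Measure E3)))
  unfold heatPiece
  rw [lintegral_tsum fun n => ((continuous_fourierInv (hint n)).enorm.measurable.pow_const 2).aemeasurable]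
  have e (n : Z3) := lintegral_enorm_fourierInv_sq (hint n) (memLp_heatSymbol_smul hα0 hα1 ht
    (Lp.memLp (𝓕 (wienerPiece φ n G) : Lp F 2 (volume : Measure E3))))
  simp_rw [e]
  refine (hφ.tsum_lintegral_heatSymbol_le α t G).trans ?_
  gcongr
  -- The `+ 1` in `cubeVolume` lets the constant of the uniform bound serve here too.
  exact le_mul_of_one_le_right zero_le le_add_self

end HeatOfPieces

/-! ### Existence and estimate of the randomization on `ℝ³` -/

section WholeSpaceEstimate

variable {Ω : Type*} [MeasurableSpace Ω] {P : Measure Ω} [IsProbabilityMeasure P] {d : ℕ}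
  {φ : E3 → ℝ} {σ : ℝ≥0} {h : Z3 → Ω → ℝ}

theorem exists_isWienerRandomization (hφ : IsCutoff φ) (hh : IsGaussianFamily P σ h) {α : ℝ}
    (hα0 : 0 < α) (hα1 : α ≤ 1) {f : 𝓢'(E3, EuclideanSpace ℂ (Fin d))} (hf : MemHdot (-α) f) :
    ∃ fω, IsWienerRandomization P α φ h f fω := by
  obtain ⟨G, hG⟩ := exists_isDpow_of_memHdot hf
  have hsum := hh.ae_summable_smul (fun n => sq_nonneg ‖wienerPiece φ n G‖)
    (hφ.summable_norm_wienerPiece_sq G) (hφ.norm_sum_wienerPiece_sq_le G)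
  choose D hD using fun G : Lp (EuclideanSpace ℂ (Fin d)) 2 (volume : Measure E3) =>
    exists_isDpow hα0 hα1 G
  -- Where the series diverges the sum is `0` by default; this concerns only a null set of `ω`.
  exact ⟨fun ω => D (∑' n, (h n ω : ℂ) • wienerPiece φ n G), G, hG,
    hsum.mono fun ω hω => ⟨_, hD _, hω.hasSum⟩⟩

theorem mixedNorm_heat_le (hφ : IsCutoff φ) (hh : IsGaussianFamily P σ h) {α p q r T : ℝ}
    (hα0 : 0 < α) (hα1 : α ≤ 1) (hp : 2 ≤ p) (hq : 2 ≤ q) (hαp : α * p ≤ 2) (hpr : p ≤ r)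
    (hqr : q ≤ r) (hT : 0 < T) {f : 𝓢'(E3, EuclideanSpace ℂ (Fin d))}
    {fω : Ω → 𝓢'(E3, EuclideanSpace ℂ (Fin d))} (hf : IsWienerRandomization P α φ h f fω) :
    AEStronglyMeasurable (fun z : Ω × ℝ × E3 => heat z.2.1 (fω z.1) z.2.2)
      (P.prod ((volume.restrict (Set.Icc 0 T)).prod volume)) ∧
    mixedNorm P volume r p q T (fun ω t x => heat t (fω ω) x) ≤
      ENNReal.ofReal (4 * √r * σ) * ((27 * cubeVolume) ^ (1 / 2 : ℝ) *
        (ENNReal.ofReal (T ^ (1 / p - α / 2)) * hdotNorm (-α) f)) := by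
  obtain ⟨G, hG, hω⟩ := hf
  have hA : ∀ᵐ z ∂((volume.restrict (Set.Icc 0 T)).prod (volume : Measure E3)),
      z ∈ {z : ℝ × E3 | 0 < z.1} := by
    have hpos : ∀ᵐ t ∂(volume.restrict (Set.Icc 0 T)), 0 < t := by
      rw [← restrict_Ioc_eq_restrict_Icc]
      filter_upwards [ae_restrict_mem measurableSet_Ioc] with t ht using ht.1
    exact Measure.quasiMeasurePreserving_fst.ae hpos
  -- The `L²` convergence holds for almost every `ω`, and evaluation at `(t,x)` with `t > 0` is
  -- continuous on `L²`; the null set is thus independent of `z`.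
  have hu : ∀ᵐ ω ∂P, ∀ z ∈ {z : ℝ × E3 | 0 < z.1},
      HasSum (fun n => (h n ω : ℂ) • heatPiece α φ G n z.1 z.2) (heat z.1 (fω ω) z.2) := by
    filter_upwards [hω] with ω ⟨Gω, hGω, hsum⟩ z hz
    obtain ⟨L, hL⟩ := exists_clm_heat_eval (F := EuclideanSpace ℂ (Fin d)) hα0.le hα1
      (show 0 < z.1 from hz) z.2
    have e : (fun n => L ((h n ω : ℂ) • wienerPiece φ n G)) =
        fun n => (h n ω : ℂ) • heatPiece α φ G n z.1 z.2 :=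
      funext fun n => by rw [map_smul, hL]; rfl
    rw [heat_eq_of_isDpow hGω, ← hL, ← e]
    exact hsum.mapL L
  obtain ⟨h1, h2⟩ := mixedNorm_le_of_hasSum P volume hp hq hpr hqr hh (T := T)
    (v := heatPiece α φ G) (u := fun ω t x => heat t (fω ω) x)
    (fun n => (stronglyMeasurable_fourierInv_heatSymbol (Lp.stronglyMeasurable _)
      α).aestronglyMeasurable) hA hu
  refine ⟨h1, h2.trans ?_⟩
  gcongr
  -- The measure `ν = |𝓕G|² dξ` has mass `‖G‖²`, the square of the homogeneous Sobolev norm of `f`.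
  refine (lintegral_square_function_le volume (volume.withDensity
    fun ξ => ‖((𝓕 G : Lp (EuclideanSpace ℂ (Fin d)) 2 (volume : Measure E3)) :
      E3 → EuclideanSpace ℂ (Fin d)) ξ‖ₑ ^ 2) continuous_freq.measurable freq_nonneg hα0 hp hq hαp
    hT (c := 27 * cubeVolume) (ENNReal.mul_ne_top (by simp) cubeVolume_ne_top)
    (fun t _ => ae_of_all _ (hφ.tsum_enorm_heatPiece_sq_le α t G))
    (fun t ht => hφ.lintegral_tsum_enorm_heatPiece_sq_le hα0.le hα1 ht G)).trans (le_of_eq ?_)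
  congr 2
  rw [withDensity_apply _ MeasurableSet.univ, Measure.restrict_univ,
    ← enorm_sq_eq_lintegral_fourier, hdotNorm_eq_of_isDpow hG, ← ENNReal.rpow_two,
    ← ENNReal.rpow_mul]
  norm_num

end WholeSpaceEstimate

/-! ### Vector valued `L²` functions on the torus -/

instance isProbabilityMeasure_unitAddCircle :
    IsProbabilityMeasure (volume : Measure UnitAddCircle) :=
  inferInstanceAs (IsProbabilityMeasure AddCircle.haarAddCircle)

section TorusL2

variable {F : Type*} [NormedAddCommGroup F] [InnerProductSpace ℂ F]

theorem coeFn_smulVec (e : Lp ℂ 2 (volume : Measure T3)) (a : F) :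
    (smulVec e a : T3 → F) =ᵐ[volume] fun x => e x • a :=
  ContinuousLinearMap.coeFn_compLp' _ e

theorem integrable_conj_smul (e : Lp ℂ 2 (volume : Measure T3))
    (G : Lp F 2 (volume : Measure T3)) :
    Integrable (fun x : T3 => (starRingEnd ℂ) (e x) • G x) := by
  have he : MemLp (fun x : T3 => (starRingEnd ℂ) (e x)) 2 volume := (Lp.memLp e).star
  exact memLp_one_iff_integrable.1 ((Lp.memLp G).smul he)

theorem mFourierCoeff_eq_coeffAlong (G : Lp F 2 (volume : Measure T3)) (m : Z3) :
    UnitAddTorus.mFourierCoeff (G : T3 → F) m = coeffAlong (UnitAddTorus.mFourierLp 2 m) G := by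
  refine integral_congr_ae ((UnitAddTorus.coeFn_mFourierLp 2 m).mono fun x hx => ?_)
  simp only [hx, UnitAddTorus.mFourier_neg]

variable [CompleteSpace F]

/-- So `smulVec e` and `coeffAlong e` are adjoint, the source of the norm and orthogonality
relations for vector valued expansions. -/
theorem inner_smulVec_left (e : Lp ℂ 2 (volume : Measure T3)) (a : F)
    (G : Lp F 2 (volume : Measure T3)) :
    inner ℂ (smulVec e a) G = inner ℂ a (coeffAlong e G) := by
  rw [coeffAlong, ← integral_inner (integrable_conj_smul e G), L2.inner_def]
  refine integral_congr_ae ((coeFn_smulVec e a).mono fun x hx => ?_)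
  simp only [hx, inner_smul_left, inner_smul_right]

theorem coeffAlong_smulVec (e e' : Lp ℂ 2 (volume : Measure T3)) (a : F) :
    coeffAlong e (smulVec e' a) = (inner ℂ e e' : ℂ) • a := by
  rw [coeffAlong, L2.inner_def, ← integral_smul_const]
  refine integral_congr_ae ((coeFn_smulVec e' a).mono fun x hx => ?_)
  simp only [hx, smul_smul, RCLike.inner_apply, mul_comm]

theorem inner_smulVec_smulVec (e e' : Lp ℂ 2 (volume : Measure T3)) (a b : F) :
    inner ℂ (smulVec e a) (smulVec e' b) = inner ℂ e e' * inner ℂ a b := by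
  rw [inner_smulVec_left, coeffAlong_smulVec, inner_smul_right]

theorem norm_smulVec (e : Lp ℂ 2 (volume : Measure T3)) (a : F) :
    ‖smulVec e a‖ = ‖e‖ * ‖a‖ := by
  have h := inner_smulVec_smulVec e e a a
  simp only [inner_self_eq_norm_sq_to_K] at h
  have h' : ‖smulVec e a‖ ^ 2 = (‖e‖ * ‖a‖) ^ 2 := by rw [mul_pow]; exact_mod_cast h
  exact (pow_left_inj₀ (norm_nonneg _) (by positivity) two_ne_zero).1 h'

/-- The isometric embedding `a ↦ e a` for a normalized `e`. -/
def smulVecIsometry (e : Lp ℂ 2 (volume : Measure T3)) (he : ‖e‖ = 1) :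
    F →ₗᵢ[ℂ] Lp F 2 (volume : Measure T3) where
  toFun a := smulVec e a
  map_add' a b := by
    ext1
    filter_upwards [coeFn_smulVec e (a + b), coeFn_smulVec e a, coeFn_smulVec e b,
      Lp.coeFn_add (smulVec e a) (smulVec e b)] with x h1 h2 h3 h4
    rw [h1, h4, Pi.add_apply, h2, h3, smul_add]
  map_smul' c a := by
    ext1
    filter_upwards [coeFn_smulVec e (c • a), coeFn_smulVec e a,
      Lp.coeFn_smul c (smulVec e a)] with x h1 h2 h3
    rw [h1, RingHom.id_apply, h3, Pi.smul_apply, h2, smul_comm]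
  norm_map' a := by
    change ‖smulVec e a‖ = ‖a‖
    rw [norm_smulVec, he, one_mul]

@[simp] theorem smulVecIsometry_apply (e : Lp ℂ 2 (volume : Measure T3)) (he : ‖e‖ = 1) (a : F) :
    smulVecIsometry e he a = smulVec e a := rfl

/-- `G ↦ ∫ \bar e G` as a continuous linear map. -/
theorem exists_clm_coeffAlong (e : Lp ℂ 2 (volume : Measure T3)) :
    ∃ L : Lp F 2 (volume : Measure T3) →L[ℂ] F, ‖L‖ ≤ ‖e‖ ∧ ∀ G, L G = coeffAlong e G := by
  have hbound (G : Lp F 2 (volume : Measure T3)) : ‖coeffAlong e G‖ ≤ ‖e‖ * ‖G‖ := by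
    by_cases h0 : coeffAlong e G = 0
    · rw [h0, norm_zero]; positivity
    -- Pair `G` with `e` times its own coefficient, use the adjunction and Cauchy–Schwarz, then
    -- divide.
    have h1 : ‖coeffAlong e G‖ ^ 2 ≤ ‖e‖ * ‖coeffAlong e G‖ * ‖G‖ := by
      have h2 := inner_smulVec_left e (coeffAlong e G) G
      rw [inner_self_eq_norm_sq_to_K] at h2
      have h3 := norm_inner_le_norm (𝕜 := ℂ) (smulVec e (coeffAlong e G)) G
      rw [h2, norm_smulVec] at h3
      simpa using h3
    have : 0 < ‖coeffAlong e G‖ := norm_pos_iff.2 h0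
    nlinarith
  let L : Lp F 2 (volume : Measure T3) →ₗ[ℂ] F :=
    { toFun := fun G => coeffAlong e G
      map_add' := fun G G' => by
        rw [coeffAlong, coeffAlong, coeffAlong,
          ← integral_add (integrable_conj_smul e G) (integrable_conj_smul e G')]
        refine integral_congr_ae ((Lp.coeFn_add G G').mono fun x hx => ?_)
        simp only [hx, Pi.add_apply, smul_add]
      map_smul' := fun c G => by
        rw [coeffAlong, coeffAlong, RingHom.id_apply, ← integral_smul]
        refine integral_congr_ae ((Lp.coeFn_smul c G).mono fun x hx => ?_)
        simp only [hx, Pi.smul_apply, smul_comm c] }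
  exact ⟨L.mkContinuous ‖e‖ hbound, L.mkContinuous_norm_le (norm_nonneg _) hbound, fun G => rfl⟩

theorem orthogonalFamily_smulVec {ι : Type*} (e : HilbertBasis ι ℂ (Lp ℂ 2 (volume : Measure T3))) :
    OrthogonalFamily ℂ (fun _ : ι => F)
      fun i => smulVecIsometry (F := F) (e i) (e.orthonormal.1 i) := by
  intro i j hij a b
  simp only [smulVecIsometry_apply]
  rw [inner_smulVec_smulVec, e.orthonormal.2 hij, zero_mul]

theorem mFourierCoeff_smulVec (e : Lp ℂ 2 (volume : Measure T3)) (a : F) (m : Z3) :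
    UnitAddTorus.mFourierCoeff (smulVec e a : T3 → F) m =
      UnitAddTorus.mFourierCoeff (e : T3 → ℂ) m • a := by
  rw [mFourierCoeff_eq_coeffAlong, coeffAlong_smulVec, ← UnitAddTorus.mFourierBasis_repr,
    HilbertBasis.repr_apply_apply, UnitAddTorus.coe_mFourierBasis]

theorem norm_mFourierLp (m : Z3) : ‖(UnitAddTorus.mFourierLp 2 m : Lp ℂ 2 (volume : Measure T3))‖ = 1 :=
  UnitAddTorus.orthonormal_mFourier.1 m

end TorusL2

/-! ### Parseval and Riesz–Fischer for vector valued functions -/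

section Parseval

variable {d : ℕ}

theorem enorm_sq_eq_sum_coord (v : EuclideanSpace ℂ (Fin d)) : ‖v‖ₑ ^ 2 = ∑ j, ‖v j‖ₑ ^ 2 := by
  simp only [enorm_sq_eq_ofReal]
  rw [EuclideanSpace.norm_sq_eq, ENNReal.ofReal_sum_of_nonneg fun _ _ => sq_nonneg _]

theorem tsum_enorm_inner_sq {ι E : Type*} [NormedAddCommGroup E]
    [InnerProductSpace ℂ E] (e : HilbertBasis ι ℂ E) (x : E) :
    ∑' i, ‖(inner ℂ (e i) x : ℂ)‖ₑ ^ 2 = ‖x‖ₑ ^ 2 := by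
  have h := RCLike.hasSum_re ℂ (e.hasSum_inner_mul_inner x x)
  have h2 : HasSum (fun i => ‖(inner ℂ (e i) x : ℂ)‖ ^ 2) (‖x‖ ^ 2) := by
    rw [inner_self_eq_norm_sq] at h
    refine h.congr_fun fun i => ?_
    rw [← inner_conj_symm x, RCLike.conj_mul]
    norm_cast
  simp only [enorm_sq_eq_ofReal]
  rw [← ENNReal.ofReal_tsum_of_nonneg (fun _ => sq_nonneg _) h2.summable, h2.tsum_eq]

/-- Parseval's identity for vector valued functions on the torus. -/
theorem tsum_enorm_coeffAlong_sq {ι : Type*} (e : HilbertBasis ι ℂ (Lp ℂ 2 (volume : Measure T3)))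
    (G : Lp (EuclideanSpace ℂ (Fin d)) 2 (volume : Measure T3)) :
    ∑' i, ‖coeffAlong (e i) G‖ₑ ^ 2 = ‖G‖ₑ ^ 2 := by
  set g : Fin d → Lp ℂ 2 (volume : Measure T3) := fun j =>
    (EuclideanSpace.proj j : EuclideanSpace ℂ (Fin d) →L[ℂ] ℂ).compLp G with hg
  have hgae (j : Fin d) : (g j : T3 → ℂ) =ᵐ[volume] fun x => G x j :=
    ContinuousLinearMap.coeFn_compLp' _ G
  have hcoord (i : ι) (j : Fin d) : coeffAlong (e i) G j = inner ℂ (e i) (g j) := by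
    have h1 := (EuclideanSpace.proj j : EuclideanSpace ℂ (Fin d) →L[ℂ] ℂ).integral_comp_comm
      (integrable_conj_smul (e i) G)
    rw [coeffAlong, L2.inner_def]
    refine h1.symm.trans (integral_congr_ae ((hgae j).mono fun x hx => ?_))
    simp [hx, mul_comm]
  simp only [enorm_sq_eq_sum_coord, hcoord]
  rw [Summable.tsum_finsetSum fun _ _ => ENNReal.summable]
  simp only [tsum_enorm_inner_sq, enorm_sq_Lp_eq]
  have e1 (j : Fin d) : ∫⁻ x, ‖g j x‖ₑ ^ 2 = ∫⁻ x, ‖G x j‖ₑ ^ 2 :=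
    lintegral_congr_ae ((hgae j).mono fun x hx => by simp only [hx])
  simp only [e1, enorm_sq_eq_sum_coord]
  refine (lintegral_finsetSum' _ fun j _ => ?_).symm
  exact (((Lp.aestronglyMeasurable (g j)).congr (hgae j)).enorm).pow_const 2

theorem tsum_enorm_mFourierCoeff_sq (G : Lp (EuclideanSpace ℂ (Fin d)) 2 (volume : Measure T3)) :
    ∑' m, ‖UnitAddTorus.mFourierCoeff (G : T3 → EuclideanSpace ℂ (Fin d)) m‖ₑ ^ 2 = ‖G‖ₑ ^ 2 := by
  rw [← tsum_enorm_coeffAlong_sq UnitAddTorus.mFourierBasis G]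
  simp only [mFourierCoeff_eq_coeffAlong, UnitAddTorus.coe_mFourierBasis]

variable {F : Type*} [NormedAddCommGroup F] [InnerProductSpace ℂ F] [CompleteSpace F]

/-- The Riesz–Fischer theorem for vector valued functions on the torus. -/
theorem exists_mFourierCoeff_eq {c : Z3 → F} (hc : Summable fun m => ‖c m‖ ^ 2) :
    ∃ G : Lp F 2 (volume : Measure T3), ∀ m, UnitAddTorus.mFourierCoeff (G : T3 → F) m = c m := by
  have hs := ((orthogonalFamily_smulVec (F := F)
    UnitAddTorus.mFourierBasis).summable_iff_norm_sq_summable c).2 hc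
  refine ⟨∑' m, smulVecIsometry (F := F) (UnitAddTorus.mFourierBasis m)
    (UnitAddTorus.mFourierBasis.orthonormal.1 m) (c m), fun m => ?_⟩
  obtain ⟨L, -, hL⟩ := exists_clm_coeffAlong (F := F) (UnitAddTorus.mFourierLp 2 m)
  rw [mFourierCoeff_eq_coeffAlong, ← hL, L.map_tsum hs, tsum_eq_single m]
  · rw [hL, smulVecIsometry_apply, coeffAlong_smulVec, UnitAddTorus.coe_mFourierBasis,
      inner_self_eq_norm_sq_to_K, norm_mFourierLp]
    simp
  · intro m' hm'
    rw [hL, smulVecIsometry_apply, coeffAlong_smulVec, UnitAddTorus.coe_mFourierBasis,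
      UnitAddTorus.orthonormal_mFourier.2 hm'.symm, zero_smul]

end Parseval

/-! ### Gaussian sums over the lattice -/

section LatticeSums

theorem summable_int_exp_neg_mul_sq {c : ℝ} (hc : 0 < c) :
    Summable fun k : ℤ => Real.exp (-c * (k : ℝ) ^ 2) := by
  have hn : Summable fun k : ℕ => Real.exp (-c * (k : ℝ) ^ 2) := by
    refine Summable.of_nonneg_of_le (fun _ => (Real.exp_pos _).le) (fun k => ?_)
      (Real.summable_exp_nat_mul_iff.2 (neg_lt_zero.2 hc))
    refine Real.exp_le_exp.2 ?_
    have : (k : ℝ) ≤ (k : ℝ) ^ 2 := by exact_mod_cast Nat.le_self_pow two_ne_zero k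
    nlinarith
  refine Summable.of_nat_of_neg (by simpa using hn) (by simpa using hn)

theorem freq_latticePoint_sq (m : Z3) :
    freq (latticePoint m) ^ 2 =
      (2 * Real.pi) ^ 2 * ((m 0 : ℝ) ^ 2 + (m 1 : ℝ) ^ 2 + (m 2 : ℝ) ^ 2) := by
  rw [freq, mul_pow, EuclideanSpace.norm_sq_eq, Fin.sum_univ_three]
  simp

theorem summable_exp_neg_mul_freq_sq {t : ℝ} (ht : 0 < t) :
    Summable fun m : Z3 => Real.exp (-t * freq (latticePoint m) ^ 2) := by
  set c := t * (2 * Real.pi) ^ 2 with hc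
  have hc0 : 0 < c := by positivity
  have h1 := summable_int_exp_neg_mul_sq hc0
  have h2 := h1.mul_of_nonneg (h1.mul_of_nonneg h1 (fun _ => (Real.exp_pos _).le)
    fun _ => (Real.exp_pos _).le) (fun _ => (Real.exp_pos _).le)
    fun _ => mul_nonneg (Real.exp_pos _).le (Real.exp_pos _).le
  have hinj : Function.Injective fun m : Z3 => (m 0, m 1, m 2) := by
    intro m m' h
    simp only [Prod.mk.injEq] at h
    funext i
    fin_cases i
    exacts [h.1, h.2.1, h.2.2]
  refine (h2.comp_injective hinj).congr fun m => ?_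
  simp only [Function.comp, ← Real.exp_add, freq_latticePoint_sq, hc]
  congr 1
  ring

theorem summable_heatSymbol {α t : ℝ} (hα0 : 0 ≤ α) (hα1 : α ≤ 1) (ht : 0 < t) :
    Summable fun m : Z3 => heatSymbol α t (freq (latticePoint m)) := by
  refine Summable.of_nonneg_of_le (fun m => heatSymbol_nonneg α t (freq_nonneg _)) (fun m => ?_)
    -- Taking the square root of `heatSymbol_sq_le` halves the time in the Gaussian.
    ((summable_exp_neg_mul_freq_sq (half_pos ht)).mul_left √(1 + 1 / t))
  have h1 := heatSymbol_sq_le hα0 hα1 ht (freq_nonneg (latticePoint m))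
  refine abs_le_of_sq_le_sq' ?_ (by positivity) |>.2
  refine h1.trans (le_of_eq ?_)
  rw [mul_pow, Real.sq_sqrt (by positivity), ← Real.exp_nat_mul]
  congr 2
  push_cast; ring

/-- A summable family tends to zero, so it takes the positive value `e^{-s²}` only finitely often.
Hence Laplace eigenfunctions are trigonometric polynomials. -/
theorem finite_freq_eq (s : ℝ) : {m : Z3 | freq (latticePoint m) = s}.Finite := by
  have h := (summable_exp_neg_mul_freq_sq one_pos).tendsto_cofinite_zero
  have h2 := h.eventually (gt_mem_nhds (Real.exp_pos (-1 * s ^ 2)))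
  refine (Filter.eventually_cofinite.1 h2).subset fun m hm => ?_
  simp only [Set.mem_ofPred_eq] at hm ⊢
  rw [hm]
  exact lt_irrefl _

end LatticeSums

/-! ### Distributions and the operators `D^{±α}` on the torus -/

section TorusDistributions

theorem latticePoint_zero : latticePoint 0 = 0 := by
  ext i
  simp

theorem freq_latticePoint_pos {m : Z3} (hm : m ≠ 0) : 0 < freq (latticePoint m) := by
  refine mul_pos (by positivity) (norm_pos_iff.2 fun h => hm (funext fun i => ?_))
  have : latticePoint m i = (0 : E3) i := by rw [h]
  simpa using this

theorem norm_mFourier_apply_le (m : Z3) (x : T3) : ‖UnitAddTorus.mFourier m x‖ ≤ 1 :=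
  (ContinuousMap.norm_coe_le_norm _ x).trans UnitAddTorus.mFourier_norm.le

theorem exists_clm_tsum {ι E F : Type*} [NormedAddCommGroup E] [NormedSpace ℂ E]
    [NormedAddCommGroup F] [NormedSpace ℂ F] [CompleteSpace F] {A : ι → E →L[ℂ] F} {w : ι → ℂ}
    {b : ι → ℝ} (hb : Summable b) (hw : ∀ i, ‖w i‖ ≤ b i) (hA : ∀ i, ‖A i‖ ≤ 1) :
    ∃ L : E →L[ℂ] F, ∀ G, L G = ∑' i, w i • A i G := by
  have hs : Summable fun i => w i • A i := by
    refine Summable.of_norm_bounded hb fun i => ?_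
    rw [norm_smul]
    exact (mul_le_of_le_one_right (norm_nonneg _) (hA i)).trans (hw i)
  exact ⟨∑' i, w i • A i, fun G => (ContinuousLinearMap.apply ℂ F G).map_tsum hs⟩

section General

variable {F : Type*} [NormedAddCommGroup F] [InnerProductSpace ℂ F]

theorem TorusIsDpow.mFourierCoeff_zero {s : ℝ} {u : TorusDistribution F}
    {G : Lp F 2 (volume : Measure T3)} (h : TorusIsDpow s u G) :
    UnitAddTorus.mFourierCoeff (G : T3 → F) 0 = 0 := by
  rw [h.2 0, if_pos rfl]

theorem TorusIsDpow.coeff_eq {α : ℝ} {u : TorusDistribution F}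
    {G : Lp F 2 (volume : Measure T3)} (h : TorusIsDpow (-α) u G) (m : Z3) :
    u.coeff m = freq (latticePoint m) ^ α • UnitAddTorus.mFourierCoeff (G : T3 → F) m := by
  by_cases hm : m = 0
  · rw [hm, h.1.1, h.mFourierCoeff_zero, smul_zero]
  · rw [h.2 m, if_neg hm, smul_smul]
    change _ = (freq (latticePoint m) ^ α * freq (latticePoint m) ^ (-α)) • u.coeff m
    rw [← Real.rpow_add (freq_latticePoint_pos hm), add_neg_cancel, Real.rpow_zero, one_smul]

theorem TorusIsDpow.torusHeat_eq {α : ℝ} {u : TorusDistribution F}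
    {G : Lp F 2 (volume : Measure T3)} (h : TorusIsDpow (-α) u G) (t : ℝ) (x : T3) :
    torusHeat t u x = ∑' m : Z3, UnitAddTorus.mFourier m x •
      (heatSymbol α t (freq (latticePoint m)) • UnitAddTorus.mFourierCoeff (G : T3 → F) m) := by
  refine tsum_congr fun m => ?_
  rw [h.coeff_eq, smul_smul, heatSymbol, freq]

variable [CompleteSpace F]

/-- The heat evolution at a positive time, evaluated at a point, is continuous on `L²(𝕋³)`. -/
theorem exists_clm_torusHeat_eval {α t : ℝ} (hα0 : 0 ≤ α) (hα1 : α ≤ 1) (ht : 0 < t) (x : T3) :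
    ∃ L : Lp F 2 (volume : Measure T3) →L[ℂ] F, ∀ G, L G = ∑' m : Z3, UnitAddTorus.mFourier m x •
      (heatSymbol α t (freq (latticePoint m)) • UnitAddTorus.mFourierCoeff (G : T3 → F) m) := by
  choose A hA1 hA2 using fun m : Z3 =>
    exists_clm_coeffAlong (F := F) (UnitAddTorus.mFourierLp 2 m)
  obtain ⟨L, hL⟩ := exists_clm_tsum (A := A)
    (w := fun m => UnitAddTorus.mFourier m x * (heatSymbol α t (freq (latticePoint m)) : ℂ))
    (summable_heatSymbol hα0 hα1 ht) (fun m => by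
      have h3 := heatSymbol_nonneg α t (freq_nonneg (latticePoint m))
      rw [norm_mul, Complex.norm_real, Real.norm_of_nonneg h3]
      exact mul_le_of_le_one_left h3 (norm_mFourier_apply_le m x))
    fun m => (hA1 m).trans (norm_mFourierLp m).le
  refine ⟨L, fun G => (hL G).trans (tsum_congr fun m => ?_)⟩
  rw [hA2, ← mFourierCoeff_eq_coeffAlong, mul_smul, Complex.coe_smul]

end General

variable {d : ℕ}

theorem tsum_enorm_sq_of_coeff_eq {α : ℝ} {u : TorusDistribution (EuclideanSpace ℂ (Fin d))}
    {G : Lp (EuclideanSpace ℂ (Fin d)) 2 (volume : Measure T3)} (h0 : u.coeff 0 = 0)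
    (h : ∀ m : Z3, UnitAddTorus.mFourierCoeff (G : T3 → EuclideanSpace ℂ (Fin d)) m =
      if m = 0 then 0 else (2 * Real.pi * ‖latticePoint m‖) ^ (-α) • u.coeff m) :
    torusHdotNorm (-α) u = ‖G‖ₑ := by
  have e (m : Z3) : ‖(2 * Real.pi * ‖latticePoint m‖) ^ (-α) • u.coeff m‖ₑ ^ 2 =
      ‖UnitAddTorus.mFourierCoeff (G : T3 → EuclideanSpace ℂ (Fin d)) m‖ₑ ^ 2 := by
    rw [h m]
    split_ifs with hm
    · rw [hm, h0, smul_zero]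
    · rfl
  rw [torusHdotNorm, tsum_congr e, tsum_enorm_mFourierCoeff_sq, ← ENNReal.rpow_two,
    ← ENNReal.rpow_mul]
  norm_num

theorem TorusIsDpow.torusHdotNorm_eq {α : ℝ} {u : TorusDistribution (EuclideanSpace ℂ (Fin d))}
    {G : Lp (EuclideanSpace ℂ (Fin d)) 2 (volume : Measure T3)} (h : TorusIsDpow (-α) u G) :
    torusHdotNorm (-α) u = ‖G‖ₑ :=
  tsum_enorm_sq_of_coeff_eq h.1.1 h.2

theorem exists_torusIsDpow_of_torusMemHdot {s : ℝ}
    {u : TorusDistribution (EuclideanSpace ℂ (Fin d))} (h : TorusMemHdot s u) :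
    ∃ G, TorusIsDpow s u G := by
  set c : Z3 → EuclideanSpace ℂ (Fin d) := fun m =>
    if m = 0 then 0 else (2 * Real.pi * ‖latticePoint m‖) ^ s • u.coeff m with hc
  have hfin : ∑' m : Z3, ‖(2 * Real.pi * ‖latticePoint m‖) ^ s • u.coeff m‖ₑ ^ 2 ≠ ∞ := by
    intro htop
    have h2 := h.2
    rw [torusHdotNorm, htop, ENNReal.top_rpow_of_pos (by norm_num)] at h2
    exact lt_irrefl _ h2
  have hs : Summable fun m => ‖c m‖ ^ 2 := by
    refine (ENNReal.summable_toReal hfin).congr fun m => ?_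
    rw [enorm_sq_eq_ofReal, ENNReal.toReal_ofReal (sq_nonneg _), hc]
    dsimp only
    split_ifs with hm
    · rw [hm, h.1, smul_zero]
    · rfl
  obtain ⟨G, hG⟩ := exists_mFourierCoeff_eq hs
  exact ⟨G, h, hG⟩

/-- The Fourier coefficients of `G` are bounded by `‖G‖`, and `s^α ≤ 1 + s`, so the coefficients of
`D^α G` grow at most linearly. -/
theorem exists_torusIsDpow {α : ℝ} (hα0 : 0 ≤ α) (hα1 : α ≤ 1)
    {G : Lp (EuclideanSpace ℂ (Fin d)) 2 (volume : Measure T3)}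
    (hG : UnitAddTorus.mFourierCoeff (G : T3 → EuclideanSpace ℂ (Fin d)) 0 = 0) :
    ∃ u, TorusIsDpow (-α) u G := by
  have hbound (m : Z3) :
      ‖UnitAddTorus.mFourierCoeff (G : T3 → EuclideanSpace ℂ (Fin d)) m‖ ≤ ‖G‖ := by
    obtain ⟨L, hL1, hL2⟩ :=
      exists_clm_coeffAlong (F := EuclideanSpace ℂ (Fin d)) (UnitAddTorus.mFourierLp 2 m)
    rw [norm_mFourierLp] at hL1
    rw [mFourierCoeff_eq_coeffAlong, ← hL2]
    exact L.le_of_opNorm_le hL1 G |>.trans_eq (one_mul _)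
  let u : TorusDistribution (EuclideanSpace ℂ (Fin d)) :=
    { coeff := fun m => freq (latticePoint m) ^ α •
        UnitAddTorus.mFourierCoeff (G : T3 → EuclideanSpace ℂ (Fin d)) m
      growth := by
        refine ⟨2 * Real.pi * ‖G‖, 1, fun m => ?_⟩
        have h1 := rpow_le_one_add (freq_nonneg (latticePoint m)) hα0 hα1
        have h2 : 1 + freq (latticePoint m) ≤ 2 * Real.pi * (1 + ‖latticePoint m‖) := by
          rw [freq, mul_add]
          linarith [Real.pi_gt_three]
        rw [norm_smul, Real.norm_of_nonneg (Real.rpow_nonneg (freq_nonneg _) _), pow_one]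
        calc _ ≤ 2 * Real.pi * (1 + ‖latticePoint m‖) * ‖G‖ := by
              gcongr
              exacts [h1.trans h2, hbound m]
          _ = _ := by ring }
  have h0 : u.coeff 0 = 0 := by
    change freq _ ^ α • _ = _
    rw [hG, smul_zero]
  have h (m : Z3) : UnitAddTorus.mFourierCoeff (G : T3 → EuclideanSpace ℂ (Fin d)) m =
      if m = 0 then 0 else (2 * Real.pi * ‖latticePoint m‖) ^ (-α) • u.coeff m := by
    split_ifs with hm
    · rw [hm, hG]
    · change _ = freq (latticePoint m) ^ (-α) • freq (latticePoint m) ^ α • _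
      rw [smul_smul, ← Real.rpow_add (freq_latticePoint_pos hm), neg_add_cancel, Real.rpow_zero,
        one_smul]
  exact ⟨u, ⟨h0, by rw [tsum_enorm_sq_of_coeff_eq h0 h]; exact enorm_lt_top⟩, h⟩

end TorusDistributions

/-! ### Laplace eigenfunctions have a single frequency -/

section Eigenfunctions

variable {e : Lp ℂ 2 (volume : Measure T3)}

theorem IsLaplaceEigenfunction.exists_freq (he : IsLaplaceEigenfunction e) :
    ∃ s : ℝ, 0 ≤ s ∧ ∀ m : Z3, UnitAddTorus.mFourierCoeff (e : T3 → ℂ) m ≠ 0 →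
      freq (latticePoint m) = s := by
  obtain ⟨he0, μ, hμ⟩ := he
  have hsq (m : Z3) (hm : UnitAddTorus.mFourierCoeff (e : T3 → ℂ) m ≠ 0) :
      freq (latticePoint m) ^ 2 = μ := smul_left_injective ℝ hm (hμ m)
  refine ⟨√μ, Real.sqrt_nonneg _, fun m hm => ?_⟩
  rw [← hsq m hm, Real.sqrt_sq (freq_nonneg _)]

theorem ae_eq_sum_mFourier {M : Finset Z3}
    (hM : ∀ m ∉ M, UnitAddTorus.mFourierCoeff (e : T3 → ℂ) m = 0) :
    (e : T3 → ℂ) =ᵐ[volume] fun x =>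
      ∑ m ∈ M, UnitAddTorus.mFourierCoeff (e : T3 → ℂ) m * UnitAddTorus.mFourier m x := by
  have h1 : e = ∑ m ∈ M, UnitAddTorus.mFourierCoeff (e : T3 → ℂ) m •
      (UnitAddTorus.mFourierLp 2 m : Lp ℂ 2 (volume : Measure T3)) := by
    have h2 := UnitAddTorus.mFourierBasis.hasSum_repr e
    simp only [UnitAddTorus.mFourierBasis_repr, UnitAddTorus.coe_mFourierBasis] at h2
    exact h2.unique (hasSum_sum_of_ne_finset_zero fun m hm => by rw [hM m hm, zero_smul])
  have h3 : ∀ᵐ x : T3, ∀ m ∈ M, (UnitAddTorus.mFourierCoeff (e : T3 → ℂ) m •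
      (UnitAddTorus.mFourierLp 2 m : Lp ℂ 2 (volume : Measure T3))) x =
      UnitAddTorus.mFourierCoeff (e : T3 → ℂ) m * UnitAddTorus.mFourier m x := by
    refine (Finset.eventually_all M).2 fun m _ => ?_
    filter_upwards [Lp.coeFn_smul (UnitAddTorus.mFourierCoeff (e : T3 → ℂ) m)
      (UnitAddTorus.mFourierLp 2 m : Lp ℂ 2 (volume : Measure T3)),
      UnitAddTorus.coeFn_mFourierLp 2 m] with x hx1 hx2
    rw [hx1, Pi.smul_apply, hx2, smul_eq_mul]
  have h4 := Lp.coeFn_finsetSum M fun m => UnitAddTorus.mFourierCoeff (e : T3 → ℂ) m •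
      (UnitAddTorus.mFourierLp 2 m : Lp ℂ 2 (volume : Measure T3))
  rw [← h1] at h4
  filter_upwards [h3, h4] with x hx3 hx4
  rw [hx4, Finset.sum_apply]
  exact Finset.sum_congr rfl hx3

variable {F : Type*} [NormedAddCommGroup F] [InnerProductSpace ℂ F]

/-- Eigenfunctions which are not orthogonal to the constants do not contribute to a function of
mean zero. -/
theorem mFourierCoeff_zero_smul_coeffAlong {s : ℝ}
    (hs : ∀ m : Z3, UnitAddTorus.mFourierCoeff (e : T3 → ℂ) m ≠ 0 → freq (latticePoint m) = s)
    {G : Lp F 2 (volume : Measure T3)} (hG : UnitAddTorus.mFourierCoeff (G : T3 → F) 0 = 0) :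
    UnitAddTorus.mFourierCoeff (e : T3 → ℂ) 0 • coeffAlong e G = 0 := by
  by_cases h0 : UnitAddTorus.mFourierCoeff (e : T3 → ℂ) 0 = 0
  · rw [h0, zero_smul]
  -- A nonzero mean forces the frequency to be zero, so `e` is a constant and its coefficient is a
  -- multiple of the vanishing mean of `G`.
  have hs0 : s = 0 := by rw [← hs 0 h0, freq, latticePoint_zero, norm_zero, mul_zero]
  have hM : ∀ m ∉ ({0} : Finset Z3), UnitAddTorus.mFourierCoeff (e : T3 → ℂ) m = 0 :=
    fun m hm => by
      by_contra h
      exact (freq_latticePoint_pos (by simpa using hm)).ne' ((hs m h).trans hs0)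
  have hae := ae_eq_sum_mFourier hM
  have : coeffAlong e G = 0 := by
    have e1 : coeffAlong e G = (starRingEnd ℂ) (UnitAddTorus.mFourierCoeff (e : T3 → ℂ) 0) •
        UnitAddTorus.mFourierCoeff (G : T3 → F) 0 := by
      clear hs hM h0
      generalize UnitAddTorus.mFourierCoeff (e : T3 → ℂ) = c at hae ⊢
      rw [coeffAlong, UnitAddTorus.mFourierCoeff, ← integral_smul]
      refine integral_congr_ae (hae.mono fun x hx => ?_)
      simp only [hx, Finset.sum_singleton, map_mul, UnitAddTorus.mFourier_neg, mul_smul]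
    rw [e1, hG, smul_zero]
  rw [this, smul_zero]

variable [CompleteSpace F]

/-- The heat evolution multiplies an eigenfunction by the value of the symbol at its frequency. -/
theorem ae_tsum_heatSymbol_smulVec {s : ℝ}
    (hs : ∀ m : Z3, UnitAddTorus.mFourierCoeff (e : T3 → ℂ) m ≠ 0 → freq (latticePoint m) = s)
    (α : ℝ) (a : F) :
    ∀ᵐ x : T3, ∀ t : ℝ, ∑' m : Z3, UnitAddTorus.mFourier m x •
      (heatSymbol α t (freq (latticePoint m)) •
        UnitAddTorus.mFourierCoeff (smulVec e a : T3 → F) m) = heatSymbol α t s • e x • a := by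
  set M := (finite_freq_eq s).toFinset with hM
  have hM0 : ∀ m ∉ M, UnitAddTorus.mFourierCoeff (e : T3 → ℂ) m = 0 := fun m hm => by
    by_contra h
    exact hm ((finite_freq_eq s).mem_toFinset.2 (hs m h))
  -- The exceptional null set comes only from writing `e` as a trigonometric polynomial, so it does
  -- not depend on `t`.
  filter_upwards [ae_eq_sum_mFourier hM0] with x hx t
  rw [tsum_eq_sum (s := M) fun m hm => by
    rw [mFourierCoeff_smulVec, hM0 m hm, zero_smul, smul_zero, smul_zero]]
  rw [hx, Finset.sum_smul, Finset.smul_sum]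
  refine Finset.sum_congr rfl fun m hm => ?_
  have : freq (latticePoint m) = s := (finite_freq_eq s).mem_toFinset.1 hm
  rw [this, mFourierCoeff_smulVec, smul_comm, smul_smul (UnitAddTorus.mFourier m x),
    mul_comm (UnitAddTorus.mFourier m x)]

end Eigenfunctions

/-! ### Existence and estimate of the randomization on `𝕋³` -/

section TorusEstimate

variable {d : ℕ} {Ω ι : Type*} [MeasurableSpace Ω] {P : Measure Ω} [IsProbabilityMeasure P]
  {e : HilbertBasis ι ℂ (Lp ℂ 2 (volume : Measure T3))} {σ : ℝ≥0} {h : ι → Ω → ℝ}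

theorem summable_norm_coeffAlong_sq (e : HilbertBasis ι ℂ (Lp ℂ 2 (volume : Measure T3)))
    (G : Lp (EuclideanSpace ℂ (Fin d)) 2 (volume : Measure T3)) :
    Summable fun i => ‖coeffAlong (e i) G‖ ^ 2 := by
  have hfin : ∑' i, ‖coeffAlong (e i) G‖ₑ ^ 2 ≠ ∞ := by
    rw [tsum_enorm_coeffAlong_sq]
    exact ENNReal.pow_ne_top enorm_ne_top
  refine (ENNReal.summable_toReal hfin).congr fun i => ?_
  rw [enorm_sq_eq_ofReal, ENNReal.toReal_ofReal (sq_nonneg _)]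

theorem norm_sum_smul_smulVec_sq (e : HilbertBasis ι ℂ (Lp ℂ 2 (volume : Measure T3)))
    (a : ι → EuclideanSpace ℂ (Fin d)) (S : Finset ι) (c : ι → ℝ) :
    ‖∑ i ∈ S, (c i : ℂ) • smulVec (e i) (a i)‖ ^ 2 = ∑ i ∈ S, c i ^ 2 * ‖a i‖ ^ 2 := by
  have h1 := (orthogonalFamily_smulVec (F := EuclideanSpace ℂ (Fin d)) e).norm_sum
    (fun i => (c i : ℂ) • a i) S
  simp only [map_smul, smulVecIsometry_apply] at h1
  rw [h1]
  refine Finset.sum_congr rfl fun i _ => ?_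
  rw [norm_smul, mul_pow, Complex.norm_real, Real.norm_eq_abs, sq_abs]

variable [Countable ι]

theorem exists_isTorusRandomization (he : ∀ i, IsLaplaceEigenfunction (e i))
    (hh : IsGaussianFamily P σ h) {α : ℝ} (hα0 : 0 ≤ α) (hα1 : α ≤ 1)
    {f : TorusDistribution (EuclideanSpace ℂ (Fin d))} (hf : TorusMemHdot (-α) f) :
    ∃ fω, IsTorusRandomization P α e h f fω := by
  obtain ⟨G, hG⟩ := exists_torusIsDpow_of_torusMemHdot hf
  have hsum := hh.ae_summable_smul (K := 1) (fun i => sq_nonneg ‖coeffAlong (e i) G‖)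
    (summable_norm_coeffAlong_sq e G)
    fun S c => by rw [norm_sum_smul_smulVec_sq e (fun i => coeffAlong (e i) G) S c, one_mul]
  have hex : ∀ᵐ ω ∂P, ∃ u, TorusIsDpow (-α) u
      (∑' i, (h i ω : ℂ) • smulVec (e i) (coeffAlong (e i) G)) := by
    filter_upwards [hsum] with ω hω
    refine exists_torusIsDpow hα0 hα1 ?_
    obtain ⟨L, -, hL⟩ :=
      exists_clm_coeffAlong (F := EuclideanSpace ℂ (Fin d)) (UnitAddTorus.mFourierLp 2 0)
    rw [mFourierCoeff_eq_coeffAlong, ← hL, L.map_tsum hω]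
    -- The random sum must have mean zero to be some `D^{-α} u`. Term by term, either `eᵢ` has mean
    -- zero or its coefficient in `G` vanishes.
    refine (tsum_congr fun i => ?_).trans tsum_zero
    obtain ⟨s, -, hs⟩ := (he i).exists_freq
    rw [map_smul, hL, ← mFourierCoeff_eq_coeffAlong, mFourierCoeff_smulVec,
      mFourierCoeff_zero_smul_coeffAlong hs hG.mFourierCoeff_zero, smul_zero]
  have hex' (ω : Ω) : ∃ v, (∃ u, TorusIsDpow (-α) u
      (∑' i, (h i ω : ℂ) • smulVec (e i) (coeffAlong (e i) G))) → TorusIsDpow (-α) v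
      (∑' i, (h i ω : ℂ) • smulVec (e i) (coeffAlong (e i) G)) := by
    by_cases hω : ∃ u, TorusIsDpow (-α) u
      (∑' i, (h i ω : ℂ) • smulVec (e i) (coeffAlong (e i) G))
    · exact ⟨hω.choose, fun _ => hω.choose_spec⟩
    · exact ⟨f, fun h' => absurd h' hω⟩
  choose fω hfω using hex'
  refine ⟨fω, G, hG, ?_⟩
  filter_upwards [hsum, hex] with ω h1 h2 using ⟨_, hfω ω h2, h1.hasSum⟩

theorem mixedNorm_torusHeat_le (he : ∀ i, IsLaplaceEigenfunction (e i)) {B : ℝ}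
    (hB : ∀ i, ∀ᵐ x : T3, ‖(e i : T3 → ℂ) x‖ ≤ B)
    (hh : IsGaussianFamily P σ h) {α p q r T : ℝ}
    (hα0 : 0 < α) (hα1 : α ≤ 1) (hp : 2 ≤ p) (hq : 2 ≤ q) (hαp : α * p ≤ 2) (hpr : p ≤ r)
    (hqr : q ≤ r) (hT : 0 < T) {f : TorusDistribution (EuclideanSpace ℂ (Fin d))}
    {fω : Ω → TorusDistribution (EuclideanSpace ℂ (Fin d))}
    (hf : IsTorusRandomization P α e h f fω) :
    AEStronglyMeasurable (fun z : Ω × ℝ × T3 => torusHeat z.2.1 (fω z.1) z.2.2)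
      (P.prod ((volume.restrict (Set.Icc 0 T)).prod volume)) ∧
    mixedNorm P volume r p q T (fun ω t x => torusHeat t (fω ω) x) ≤
      ENNReal.ofReal (4 * √r * σ) * (ENNReal.ofReal B *
        (ENNReal.ofReal (T ^ (1 / p - α / 2)) * torusHdotNorm (-α) f)) := by
  obtain ⟨G, hG, hω⟩ := hf
  choose s hs0 hs using fun i => (he i).exists_freq
  set a : ι → EuclideanSpace ℂ (Fin d) := fun i => coeffAlong (e i) G with ha
  set v : ι → ℝ → T3 → EuclideanSpace ℂ (Fin d) := fun i t x =>
    heatSymbol α t (s i) • (e i : T3 → ℂ) x • a i with hv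
  -- The `eᵢ` are only classes of functions, so the formula for the heat flow holds off a null set.
  -- Countability of `ι` gives a set that works for all `i` and `t`.
  set X : Set T3 := {x | ∀ i, ∀ t : ℝ, ∑' m : Z3, UnitAddTorus.mFourier m x •
      (heatSymbol α t (freq (latticePoint m)) • UnitAddTorus.mFourierCoeff
        (smulVec (e i) (a i) : T3 → EuclideanSpace ℂ (Fin d)) m) = v i t x} with hX
  have hXae : ∀ᵐ x : T3, x ∈ X :=
    ae_all_iff.2 fun i => ae_tsum_heatSymbol_smulVec (hs i) α (a i)
  have hA : ∀ᵐ z ∂((volume.restrict (Set.Icc 0 T)).prod (volume : Measure T3)),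
      z ∈ {z : ℝ × T3 | 0 < z.1 ∧ z.2 ∈ X} := by
    have hpos : ∀ᵐ t ∂(volume.restrict (Set.Icc 0 T)), 0 < t := by
      rw [← restrict_Ioc_eq_restrict_Icc]
      filter_upwards [ae_restrict_mem measurableSet_Ioc] with t ht using ht.1
    filter_upwards [Measure.quasiMeasurePreserving_fst.ae hpos,
      Measure.quasiMeasurePreserving_snd.ae hXae] with z h1 h2 using ⟨h1, h2⟩
  have hu : ∀ᵐ ω ∂P, ∀ z ∈ {z : ℝ × T3 | 0 < z.1 ∧ z.2 ∈ X},
      HasSum (fun i => (h i ω : ℂ) • v i z.1 z.2) (torusHeat z.1 (fω ω) z.2) := by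
    filter_upwards [hω] with ω ⟨Gω, hGω, hsum⟩ z hz
    obtain ⟨L, hL⟩ := exists_clm_torusHeat_eval (F := EuclideanSpace ℂ (Fin d)) hα0.le hα1
      hz.1 z.2
    have e1 : (fun i => L ((h i ω : ℂ) • smulVec (e i) (a i))) =
        fun i => (h i ω : ℂ) • v i z.1 z.2 :=
      funext fun i => by rw [map_smul, hL, hz.2 i z.1]
    rw [hGω.torusHeat_eq, ← hL, ← e1]
    exact hsum.mapL L
  have hvm (i : ι) : AEStronglyMeasurable (fun z : ℝ × T3 => v i z.1 z.2)
      ((volume.restrict (Set.Icc 0 T)).prod volume) := by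
    have h1 : Measurable fun z : ℝ × T3 => heatSymbol α z.1 (s i) :=
      (measurable_heatSymbol α).comp (measurable_fst.prodMk measurable_const)
    exact (h1.stronglyMeasurable.smul (((Lp.stronglyMeasurable (e i)).comp_measurable
      measurable_snd).smul_const (a i))).aestronglyMeasurable
  obtain ⟨h1, h2⟩ := mixedNorm_le_of_hasSum P volume hp hq hpr hqr hh (T := T)
    (v := v) (u := fun ω t x => torusHeat t (fω ω) x) hvm hA hu
  refine ⟨h1, h2.trans ?_⟩
  gcongr
  let _ : MeasurableSpace ι := ⊤
  -- The discrete counterpart of `|𝓕G|² dξ`: mass `‖aᵢ‖²` at the index `i`, which carries the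
  -- frequency `s i`. By Parseval its total mass is `‖G‖²`.
  set ν : Measure ι := Measure.sum fun i => ‖a i‖ₑ ^ 2 • Measure.dirac i with hν
  have hνint (g : ι → ℝ≥0∞) : ∫⁻ i, g i ∂ν = ∑' i, ‖a i‖ₑ ^ 2 * g i := by
    rw [hν, lintegral_sum_measure]
    refine tsum_congr fun i => ?_
    rw [lintegral_smul_measure, lintegral_dirac, smul_eq_mul]
  have hpt (t : ℝ) : ∀ᵐ x : T3, ∑' i, ‖v i t x‖ₑ ^ 2 ≤
      ENNReal.ofReal B ^ 2 * ∫⁻ i, ENNReal.ofReal (heatSymbol α t (s i)) ^ 2 ∂ν := by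
    filter_upwards [ae_all_iff.2 hB] with x hx
    rw [hνint, ← ENNReal.tsum_mul_left]
    refine ENNReal.tsum_le_tsum fun i => ?_
    have hx' : ‖(e i : T3 → ℂ) x‖ₑ ≤ ENNReal.ofReal B := by
      rw [← ofReal_norm]
      exact ENNReal.ofReal_le_ofReal (hx i)
    rw [hv]
    simp only [enorm_smul, Real.enorm_of_nonneg (heatSymbol_nonneg α t (hs0 i)), mul_pow]
    calc _ ≤ ENNReal.ofReal (heatSymbol α t (s i)) ^ 2 *
          (ENNReal.ofReal B ^ 2 * ‖a i‖ₑ ^ 2) := by gcongr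
      _ = _ := by ring
  refine (lintegral_square_function_le volume ν (s := s) measurable_from_top hs0 hα0 hp hq hαp
    hT (c := ENNReal.ofReal B ^ 2) (ENNReal.pow_ne_top ENNReal.ofReal_ne_top)
    (fun t _ => hpt t) fun t _ => ?_).trans (le_of_eq ?_)
  · refine (lintegral_mono_ae (hpt t)).trans (le_of_eq ?_)
    -- On a probability space the uniform bound is also the `L¹` bound.
    rw [lintegral_const, measure_univ, mul_one]
  · have hsq (y : ℝ≥0∞) : (y ^ 2) ^ (1 / 2 : ℝ) = y := by
      rw [← ENNReal.rpow_two, ← ENNReal.rpow_mul]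
      norm_num
    have hνuniv : ν Set.univ = ‖G‖ₑ ^ 2 := by
      rw [← tsum_enorm_coeffAlong_sq e G, ← lintegral_one, hνint]
      simp only [mul_one, ha]
    rw [hνuniv, hsq, hsq, hG.torusHdotNorm_eq]

end TorusEstimate

end RandomHeat

end

/-! ### Assembly of the two estimates -/

open RandomHeat in
theorem proposition2p4 {α p q : ℝ} (hα0 : 0 < α) (hα1 : α < 1) (hp : 2 ≤ p) (hq : 2 ≤ q)
    (hαp : α * p ≤ 2) :
    ∃ C : ℝ, 0 < C ∧
      ∀ (d : ℕ) (r T : ℝ) (σ : ℝ≥0), p ≤ r → q ≤ r → 0 < T →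
      ∀ {Ω : Type*} [MeasurableSpace Ω] (P : Measure Ω) [IsProbabilityMeasure P],
        -- the whole space
        (∀ φ : E3 → ℝ, IsCutoff φ →
          ∀ h : Z3 → Ω → ℝ, IsGaussianFamily P σ h →
          ∀ f : 𝓢'(E3, EuclideanSpace ℂ (Fin d)), MemHdot (-α) f →
            (∃ fω, IsWienerRandomization P α φ h f fω) ∧
            ∀ fω, IsWienerRandomization P α φ h f fω →
              AEStronglyMeasurable
                (fun z : Ω × ℝ × E3 => heat z.2.1 (fω z.1) z.2.2)
                (P.prod ((volume.restrict (Set.Icc 0 T)).prod volume)) ∧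
              mixedNorm P volume r p q T (fun ω t x => heat t (fω ω) x) ≤
                ENNReal.ofReal (C * σ * √r * T ^ (1 / p - α / 2)) * hdotNorm (-α) f) ∧
        -- the torus
        (∀ {ι : Type*} [Countable ι] (e : HilbertBasis ι ℂ (Lp ℂ 2 (volume : Measure T3))) (B : ℝ),
          (∀ i, IsLaplaceEigenfunction (e i)) →
          (∀ i, ∀ᵐ x : T3, ‖(e i : T3 → ℂ) x‖ ≤ B) →
          ∀ h : ι → Ω → ℝ, IsGaussianFamily P σ h →
          ∀ f : TorusDistribution (EuclideanSpace ℂ (Fin d)), TorusMemHdot (-α) f →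
            (∃ fω, IsTorusRandomization P α e h f fω) ∧
            ∀ fω, IsTorusRandomization P α e h f fω →
              AEStronglyMeasurable
                (fun z : Ω × ℝ × T3 => torusHeat z.2.1 (fω z.1) z.2.2)
                (P.prod ((volume.restrict (Set.Icc 0 T)).prod volume)) ∧
              mixedNorm P volume r p q T (fun ω t x => torusHeat t (fω ω) x) ≤
                ENNReal.ofReal (C * B * σ * √r * T ^ (1 / p - α / 2)) *
                  torusHdotNorm (-α) f) := by
  set k : ℝ := ((27 * cubeVolume) ^ (1 / 2 : ℝ)).toReal with hk
  have hk0 : 0 ≤ k := ENNReal.toReal_nonneg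
  have hkeq : (27 * cubeVolume) ^ (1 / 2 : ℝ) = ENNReal.ofReal k :=
    (ENNReal.ofReal_toReal (ENNReal.rpow_ne_top_of_nonneg (by norm_num)
      (ENNReal.mul_ne_top (by simp) cubeVolume_ne_top))).symm
  -- The comparison `4 b ≤ C` is needed only for `b > 0`: the sign of `B` is not prescribed, and for
  -- `b ≤ 0` the left side is zero.
  have hcomb {r T : ℝ} (σ : ℝ≥0) (b C : ℝ) (hC : 0 < b → 4 * b ≤ C) (hT : 0 < T)
      (N : ℝ≥0∞) :
      ENNReal.ofReal (4 * √r * σ) *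
        (ENNReal.ofReal b * (ENNReal.ofReal (T ^ (1 / p - α / 2)) * N)) ≤
      ENNReal.ofReal (C * σ * √r * T ^ (1 / p - α / 2)) * N := by
    rcases le_or_gt b 0 with hb | hb
    · rw [ENNReal.ofReal_of_nonpos hb, zero_mul, mul_zero]
      exact zero_le
    rw [← mul_assoc, ← mul_assoc, ← ENNReal.ofReal_mul (by positivity),
      ← ENNReal.ofReal_mul (by positivity)]
    refine mul_le_mul_left (ENNReal.ofReal_le_ofReal ?_) N
    calc 4 * √r * σ * b * T ^ (1 / p - α / 2) = 4 * b * (σ * √r * T ^ (1 / p - α / 2)) := by ring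
      _ ≤ C * (σ * √r * T ^ (1 / p - α / 2)) := by
        have := hC hb
        gcongr
      _ = _ := by ring
  -- The space estimate needs `4k`, the torus estimate `4B`; the sum covers both and is positive. It
  -- involves neither `p`, `q` nor `α`.
  refine ⟨4 * k + 4, by positivity, fun d r T σ hpr hqr hT Ω _ P _ => ⟨?_, ?_⟩⟩
  · intro φ hφ h hh f hf
    refine ⟨exists_isWienerRandomization hφ hh hα0 hα1.le hf, fun fω hfω => ?_⟩
    obtain ⟨h1, h2⟩ := mixedNorm_heat_le hφ hh hα0 hα1.le hp hq hαp hpr hqr hT hfω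
    refine ⟨h1, h2.trans ?_⟩
    rw [hkeq]
    exact hcomb σ k (4 * k + 4) (fun _ => by linarith) hT _
  · intro ι _ e B he hB h hh f hf
    refine ⟨exists_isTorusRandomization he hh hα0.le hα1.le hf, fun fω hfω => ?_⟩
    obtain ⟨h1, h2⟩ := mixedNorm_torusHeat_le he hB hh hα0 hα1.le hp hq hαp hpr hqr hT hfω
    exact ⟨h1, h2.trans (hcomb σ B ((4 * k + 4) * B) (fun hB0 => by nlinarith) hT _)⟩
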